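/- Let $\mathcal{H}$ be a real Hilbert space and let $J\in\mathcal{B}(\mathcal{H})$ satisfy $J^2=-1$ and $J^*=-J$. Put $w(\xi,\eta)=\langle J\xi,\eta\rangle$. Let ${\rm Sp}(\mathcal{H})$ be the group of invertible bounded operators preserving $w$, and let ${\rm Sp}_2(\mathcal{H})$ be the set of $g\in {\rm Sp}(\mathcal{H})$ such that $g-1$ is Hilbert–Schmidt. Let $\Lambda(\mathcal{H})$ be the set of closed subspaces $L\subset\mathcal{H}$ with $J(L)=L^\perp$. For a Hilbert space $E$ let $\mathcal{B}(E)_s$ be the Banach space of symmetric bounded operators on $E$ with the operator norm, and let $\mathcal{B}_2(E)_s$ be the Hilbert space of symmetric Hilbert–Schmidt operators on $E$ with inner product $\langle a,b\rangle={\rm Tr}(b^*a)$. For $L\in\Lambda(\mathcal{H})$ let $$\Omega(L^\perp)=\{W\in\Lambda(\mathcal{H}) : \mathcal{H}=W\oplus L^\perp\},\qquad \phi_L:\Omega(L^\perp)\to\mathcal{B}(L)_s,\quad \phi_L(W)=J|_{L^\perp}T,$$ where $T:L\to L^\perp$ is the bounded operator whose graph $\{v+Tv : v\in L\}$ is $W$.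 Fix $L_0\in\Lambda(\mathcal{H})$ and let $\mathcal{O}_{L_0}=\{g(L_0) : g\in{\rm Sp}_2(\mathcal{H})\}\subset\Lambda(\mathcal{H})$. Then: 1. $\Lambda(\mathcal{H})$ is a smooth Banach manifold whose charts are the bijections $\phi_L:\Omega(L^\perp)\to\mathcal{B}(L)_s$, $L\in\Lambda(\mathcal{H})$: each $\Omega(L^\perp)$ is open and each $\phi_L$ is a smooth diffeomorphism onto $\mathcal{B}(L)_s$. 2. For each $L\in\mathcal{O}_{L_0}$, $\phi_L$ maps $\Omega(L^\perp)\cap\mathcal{O}_{L_0}$ onto $\mathcal{B}_2(L)_s$. With these restrictions as charts, $\mathcal{O}_{L_0}$ is a smooth Hilbert manifold: each $\Omega(L^\perp)\cap\mathcal{O}_{L_0}$ with $L\in\mathcal{O}_{L_0}$ is open in $\mathcal{O}_{L_0}$, and the restriction of $\phi_L$ to it is a smooth diffeomorphism onto $\mathcal{B}_2(L)_s$ with the norm $\|\cdot\|_2$. 3. For these manifold structures $\mathcal{O}_{L_0}$ is an immersed submanifold of $\Lambda(\mathcal{H})$: the inclusion $i:\mathcal{O}_{L_0}\hookrightarrow\Lambda(\mathcal{H})$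 is an immersion, that is, it is smooth and its differential is injective at every point. -/

import Mathlib

open Set Topology
open scoped Manifold ContDiff InnerProductSpace

noncomputable section

/-! ### Hilbert-Schmidt operators -/

section HilbertSchmidt

variable {E F : Type*} [NormedAddCommGroup E] [InnerProductSpace ℝ E] [CompleteSpace E]
  [NormedAddCommGroup F] [InnerProductSpace ℝ F]

variable (E) in
/-- Index set of the orthonormal basis `stdHilbertBasis E`. -/
def stdIndex : Set E := Classical.choose (exists_hilbertBasis ℝ E)

variable (E) in
/-- Some (chosen) orthonormal basis of the real Hilbert space `E`. -/
def stdHilbertBasis : HilbertBasis (stdIndex E) ℝ E :=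
  Classical.choose (Classical.choose_spec (exists_hilbertBasis ℝ E))

/-- `a` is a Hilbert-Schmidt operator: `Tr (a* a) = ∑ i, ‖a e_i‖ ^ 2 < ∞`, with `(e_i)` an
orthonormal basis. The choice of the basis is irrelevant, see `isHilbertSchmidt_iff`. -/
def IsHilbertSchmidt (a : E →L[ℝ] F) : Prop :=
  Summable fun i => ‖a (stdHilbertBasis E i)‖ ^ 2

lemma HilbertBasis.tsum_ofReal_inner_sq {ι : Type*} (b : HilbertBasis ι ℝ F) (x : F) :
    ∑' i, ENNReal.ofReal (inner ℝ (b i) x ^ 2) = ENNReal.ofReal (‖x‖ ^ 2) := by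
  have h := b.hasSum_inner_mul_inner x x
  have h' : HasSum (fun i => inner ℝ (b i) x ^ 2) (‖x‖ ^ 2) := by
    rw [real_inner_self_eq_norm_sq] at h
    have h2 : (fun i => inner ℝ (b i) x ^ 2) = fun i => inner ℝ x (b i) * inner ℝ (b i) x :=
      funext fun i => by rw [real_inner_comm x (b i), sq]
    rw [h2]
    exact h
  rw [← h'.tsum_eq, ENNReal.ofReal_tsum_of_nonneg (fun i => sq_nonneg _) h'.summable]

lemma tsum_norm_sq_adjoint [CompleteSpace F] {ι κ : Type*} (b : HilbertBasis ι ℝ E) (c : HilbertBasis κ ℝ F)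
    (a : E →L[ℝ] F) :
    ∑' i, ENNReal.ofReal (‖a (b i)‖ ^ 2) =
      ∑' j, ENNReal.ofReal (‖ContinuousLinearMap.adjoint a (c j)‖ ^ 2) := by
  simp_rw [← c.tsum_ofReal_inner_sq, ← b.tsum_ofReal_inner_sq]
  rw [ENNReal.tsum_comm]
  simp_rw [ContinuousLinearMap.adjoint_inner_right, real_inner_comm]

lemma tsum_norm_sq_basis [CompleteSpace F] {ι κ : Type*} (b : HilbertBasis ι ℝ E) (c : HilbertBasis κ ℝ E)
    (a : E →L[ℝ] F) :
    ∑' i, ENNReal.ofReal (‖a (b i)‖ ^ 2) = ∑' j, ENNReal.ofReal (‖a (c j)‖ ^ 2) := by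
  rw [tsum_norm_sq_adjoint b (stdHilbertBasis F), tsum_norm_sq_adjoint c (stdHilbertBasis F)]

lemma summable_iff_tsum_ofReal_ne_top {κ : Type*} (f : κ → ℝ) (hf : ∀ k, 0 ≤ f k) :
    Summable f ↔ ∑' k, ENNReal.ofReal (f k) ≠ ⊤ := by
  refine ⟨fun h => h.tsum_ofReal_ne_top, fun h => ?_⟩
  simpa [ENNReal.toReal_ofReal, hf] using ENNReal.summable_toReal h

/-- The Hilbert-Schmidt condition may be tested on any orthonormal basis. -/
lemma isHilbertSchmidt_iff [CompleteSpace F] {ι : Type*} (b : HilbertBasis ι ℝ E)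
    (a : E →L[ℝ] F) : IsHilbertSchmidt a ↔ Summable fun i => ‖a (b i)‖ ^ 2 := by
  unfold IsHilbertSchmidt
  rw [summable_iff_tsum_ofReal_ne_top _ (fun _ => sq_nonneg _),
    summable_iff_tsum_ofReal_ne_top _ (fun _ => sq_nonneg _),
    tsum_norm_sq_basis (stdHilbertBasis E) b a]

lemma isHilbertSchmidt_iff_memℓp (a : E →L[ℝ] F) :
    IsHilbertSchmidt a ↔ Memℓp (E := fun _ => F) (fun i => a (stdHilbertBasis E i)) 2 := by
  rw [memℓp_gen_iff (by norm_num)]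
  simp [IsHilbertSchmidt]

end HilbertSchmidt

/-! ### Spaces of symmetric operators -/

section Symmetric

variable (E : Type*) [NormedAddCommGroup E] [InnerProductSpace ℝ E] [CompleteSpace E]

/-- The Banach space `B(E)_s` of symmetric bounded operators, with the operator norm. -/
abbrev SymOp : Type _ := selfAdjoint.submodule ℝ (E →L[ℝ] E)

/-- The symmetric Hilbert-Schmidt operators as a linear subspace of `B(E)`. -/
def hsSymSubmodule : Submodule ℝ (E →L[ℝ] E) where
  carrier := {a | IsSelfAdjoint a ∧ IsHilbertSchmidt a}
  add_mem' {a b} ha hb := ⟨ha.1.add hb.1, (isHilbertSchmidt_iff_memℓp _).2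
    (((isHilbertSchmidt_iff_memℓp a).1 ha.2).add ((isHilbertSchmidt_iff_memℓp b).1 hb.2))⟩
  zero_mem' := ⟨IsSelfAdjoint.zero _, by simp [IsHilbertSchmidt, summable_zero]⟩
  smul_mem' r a ha := ⟨(selfAdjoint.submodule ℝ (E →L[ℝ] E)).smul_mem r ha.1, by
    simpa [IsHilbertSchmidt, norm_smul, mul_pow] using Summable.mul_left (r ^ 2) ha.2⟩

/-- The space `B₂(E)_s` of symmetric Hilbert-Schmidt operators; it carries the inner product
`⟪a, b⟫ = Tr (b* a)` and the 2-norm, not the operator norm. -/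
def HSSym : Type _ := hsSymSubmodule E

namespace HSSym

instance : AddCommGroup (HSSym E) := inferInstanceAs (AddCommGroup (hsSymSubmodule E))

instance : Module ℝ (HSSym E) := inferInstanceAs (Module ℝ (hsSymSubmodule E))

variable {E}

/-- The underlying bounded operator. -/
def toCLM (a : HSSym E) : E →L[ℝ] E := Subtype.val (p := fun x => x ∈ hsSymSubmodule E) a

variable (E) in
/-- The linear map `a ↦ (a e_i)_i` into the Hilbert sum `ℓ²(E)`. -/
def toLp : HSSym E →ₗ[ℝ] lp (fun _ : stdIndex E => E) 2 where
  toFun a := ⟨fun i => a.toCLM (stdHilbertBasis E i), (isHilbertSchmidt_iff_memℓp _).1 a.2.2⟩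
  map_add' _ _ := rfl
  map_smul' _ _ := rfl

lemma toLp_injective : Function.Injective (toLp E) := by
  intro a b h
  refine Subtype.ext (ContinuousLinearMap.ext_on
    (Submodule.dense_iff_topologicalClosure_eq_top.2 (stdHilbertBasis E).dense_span) ?_)
  rintro _ ⟨i, rfl⟩
  exact congrFun (congrArg Subtype.val h) i

instance : NormedAddCommGroup (HSSym E) :=
  NormedAddCommGroup.induced (HSSym E) (lp (fun _ : stdIndex E => E) 2) (toLp E) toLp_injective

instance : InnerProductSpace ℝ (HSSym E) where
  toNormedSpace := NormedSpace.induced ℝ (HSSym E) (lp (fun _ : stdIndex E => E) 2) (toLp E)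
  inner a b := inner ℝ (toLp E a) (toLp E b)
  norm_sq_eq_re_inner a := norm_sq_eq_re_inner (𝕜 := ℝ) (toLp E a)
  conj_inner_symm a b := inner_conj_symm _ _
  add_left a b c := by rw [map_add, inner_add_left]
  smul_left a b r := by rw [map_smul, inner_smul_left]

/-- The inner product is `⟪a, b⟫ = Tr (b* a) = ∑ i, ⟪a e_i, b e_i⟫`. -/
lemma inner_eq_tsum (a b : HSSym E) :
    inner ℝ a b = ∑' i, inner ℝ (a.toCLM (stdHilbertBasis E i)) (b.toCLM (stdHilbertBasis E i)) :=
  lp.inner_eq_tsum (𝕜 := ℝ) (toLp E a) (toLp E b)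

lemma isometry_toLp : Isometry (toLp E) :=
  AddMonoidHomClass.isometry_of_norm _ fun _ => rfl

lemma range_toLp : range (toLp E) = {v | ∀ i j : stdIndex E,
    inner ℝ (v i) (stdHilbertBasis E j) = inner ℝ (stdHilbertBasis E i) (v j)} := by
  ext v
  constructor
  · rintro ⟨a, rfl⟩ i j
    exact (ContinuousLinearMap.isSelfAdjoint_iff_isSymmetric.1 a.2.1) _ _
  · intro hv
    set b := stdHilbertBasis E
    have hmem : ∀ x : E, Memℓp (E := fun _ : stdIndex E => ℝ) (fun i => inner ℝ (v i) x) 2 := by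
      intro x
      have h1 := lp.memℓp v
      rw [memℓp_gen_iff (by norm_num)] at h1 ⊢
      refine Summable.of_nonneg_of_le (fun i => by positivity) (fun i => ?_)
        (h1.mul_right (‖x‖ ^ (2 : ENNReal).toReal))
      rw [← Real.mul_rpow (norm_nonneg _) (norm_nonneg _)]
      exact Real.rpow_le_rpow (norm_nonneg _) (norm_inner_le_norm _ _) (by norm_num)
    let T : E →ₗ[ℝ] E :=
      b.repr.symm.toLinearEquiv.toLinearMap ∘ₗ
        { toFun := fun x => (⟨fun i => inner ℝ (v i) x, hmem x⟩ : lp (fun _ : stdIndex E => ℝ) 2)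
          map_add' := fun x y => by ext i; exact inner_add_right _ _ _
          map_smul' := fun r x => by ext i; exact inner_smul_right _ _ _ }
    have hT : ∀ x i, inner ℝ (b i) (T x) = inner ℝ (v i) x := by
      intro x i
      rw [← b.repr_apply_apply]
      simp [T]
    have hTb : ∀ j, T (b j) = v j := by
      intro j
      apply b.repr.injective
      ext i
      rw [b.repr_apply_apply, b.repr_apply_apply, hT, hv i j]
    have hcont : Continuous T := by
      refine T.continuous_of_seq_closed_graph fun u x y hu hTu => ?_
      apply b.repr.injective
      ext i
      rw [b.repr_apply_apply, b.repr_apply_apply, hT]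
      refine tendsto_nhds_unique (tendsto_const_nhds.inner hTu) ?_
      simp only [Function.comp_apply, hT]
      exact tendsto_const_nhds.inner hu
    let S : E →L[ℝ] E := ⟨T, hcont⟩
    have hS : IsSelfAdjoint S := by
      refine ContinuousLinearMap.ext_on
        (Submodule.dense_iff_topologicalClosure_eq_top.2 b.dense_span) ?_
      rintro _ ⟨i, rfl⟩
      refine ext_inner_right ℝ fun x => ?_
      rw [ContinuousLinearMap.star_eq_adjoint, ContinuousLinearMap.adjoint_inner_left]
      change inner ℝ (b i) (T x) = inner ℝ (T (b i)) x
      rw [hT, hTb]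
    refine ⟨⟨S, hS, (isHilbertSchmidt_iff_memℓp S).2 ?_⟩, ?_⟩
    · have : (fun i => S (stdHilbertBasis E i)) = v := funext hTb
      rw [this]
      exact lp.memℓp v
    · exact Subtype.ext (funext hTb)

/-- `B₂(E)_s` is a Hilbert space. -/
instance : CompleteSpace (HSSym E) := by
  have hc : IsClosed (range (toLp E)) := by
    rw [range_toLp]
    simp only [ofPred_forall]
    refine isClosed_iInter fun i => isClosed_iInter fun j => isClosed_eq ?_ ?_
    · exact ((lp.lipschitzWith_one_eval 2 i).continuous).inner continuous_const
    · exact continuous_const.inner (lp.lipschitzWith_one_eval 2 j).continuous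
  exact (completeSpace_iff_isComplete_range isometry_toLp.isUniformInducing).2 hc.isComplete

end HSSym

end Symmetric

/-! ### The Lagrangian Grassmannian and the restricted orbit -/

section Lagrangian

variable {H : Type*} [NormedAddCommGroup H] [InnerProductSpace ℝ H]

/-- The symplectic form `w(ξ, η) = ⟪J ξ, η⟫`. -/
def symplecticForm (J : H →L[ℝ] H) (ξ η : H) : ℝ := inner ℝ (J ξ) η

/-- The symplectic group `Sp(H)`: the invertible bounded operators preserving `w`. -/
def symplecticGroup (J : H →L[ℝ] H) : Set (H ≃L[ℝ] H) :=
  {g | ∀ ξ η, symplecticForm J (g ξ) (g η) = symplecticForm J ξ η}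

/-- The restricted symplectic group `Sp₂(H)`: the `g ∈ Sp(H)` with `g - 1` Hilbert-Schmidt. -/
def restrictedSymplecticGroup [CompleteSpace H] (J : H →L[ℝ] H) : Set (H ≃L[ℝ] H) :=
  {g | g ∈ symplecticGroup J ∧
    IsHilbertSchmidt ((g : H →L[ℝ] H) - ContinuousLinearMap.id ℝ H)}

/-- The Lagrangian Grassmannian `Λ(H)`: the closed subspaces `L` of `H` with `J(L) = Lᗮ`. -/
@[ext]
structure Lagrangian (J : H →L[ℝ] H) where
  /-- The underlying subspace. -/
  space : Submodule ℝ H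
  isClosed : IsClosed (space : Set H)
  map_eq : space.map (J : H →ₗ[ℝ] H) = spaceᗮ

variable [CompleteSpace H] {J : H →L[ℝ] H}

instance (L : Lagrangian J) : CompleteSpace L.space := L.isClosed.completeSpace_coe

/-- The orbit `O_{L₀} = {g(L₀) : g ∈ Sp₂(H)}`, as a subset of `Λ(H)`. -/
def restrictedOrbit (L₀ : Lagrangian J) : Set (Lagrangian J) :=
  {W | ∃ g ∈ restrictedSymplecticGroup J, W.space = L₀.space.map (g : H →ₗ[ℝ] H)}

/-- The orbit `O_{L₀}` as a type of its own, so that it does not silently carry the subspace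
topology. -/
def RestrictedOrbit (L₀ : Lagrangian J) : Type _ := {W : Lagrangian J // W ∈ restrictedOrbit L₀}

/-- The inclusion `O_{L₀} → Λ(H)`. -/
def RestrictedOrbit.incl (L₀ : Lagrangian J) (W : RestrictedOrbit L₀) : Lagrangian J :=
  Subtype.val (p := fun W => W ∈ restrictedOrbit L₀) W

/-- `Ω(Lᗮ) = {W ∈ Λ(H) : H = W ⊕ Lᗮ}`. -/
def graphDomain (L : Lagrangian J) : Set (Lagrangian J) := {W | IsCompl W.space L.spaceᗮ}

/-- The restriction `π₀|_W : W → L` of the orthogonal projection onto `L`. -/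
def proj₀ (L W : Lagrangian J) : W.space →L[ℝ] L.space :=
  L.space.orthogonalProjectionOnto ∘L W.space.subtypeL

/-- The restriction `π₁|_W : W → Lᗮ` of the orthogonal projection onto `Lᗮ`. -/
def proj₁ (L W : Lagrangian J) : W.space →L[ℝ] L.spaceᗮ :=
  L.spaceᗮ.orthogonalProjectionOnto ∘L W.space.subtypeL

/-- The operator `T = π₁|_W ∘ (π₀|_W)⁻¹ : L → Lᗮ` whose graph is `W`, for `W ∈ Ω(Lᗮ)`. -/
def graphOp (L W : Lagrangian J) : L.space →L[ℝ] L.spaceᗮ := proj₁ L W ∘L (proj₀ L W).inverse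

/-- The graph chart `φ_L(W) = J|_{Lᗮ} T`, for `W ∈ Ω(Lᗮ)`. Since `J(Lᗮ) = L`, the final projection
onto `L` only serves to regard `J|_{Lᗮ}` as a map with values in `L`. -/
def graphChart (L W : Lagrangian J) : L.space →L[ℝ] L.space :=
  (L.space.orthogonalProjectionOnto ∘L J ∘L L.spaceᗮ.subtypeL) ∘L graphOp L W

/-- For `W ∈ Ω(Lᗮ)` the map `π₀|_W` is invertible, so that `graphOp L W` is meaningful. -/
lemma isInvertible_proj₀ {L W : Lagrangian J} (hW : W ∈ graphDomain L) :
    (proj₀ L W).IsInvertible := by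
  have hW' : IsCompl W.space L.spaceᗮ := hW
  refine ⟨ContinuousLinearEquiv.ofBijective (proj₀ L W) ?_ ?_, ?_⟩
  · rw [LinearMap.ker_eq_bot']
    intro x hx
    have h1 : (x : H) ∈ L.spaceᗮ :=
      L.space.orthogonalProjectionOnto_eq_zero_iff.1 hx
    have h2 := Submodule.disjoint_def.1 hW'.disjoint x x.2 h1
    exact Subtype.ext h2
  · rw [LinearMap.range_eq_top]
    intro y
    obtain ⟨w, hw, z, hz, h⟩ := Submodule.mem_sup.1
      (hW'.sup_eq_top ▸ Submodule.mem_top (x := (y : H)))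
    refine ⟨⟨w, hw⟩, ?_⟩
    change L.space.orthogonalProjectionOnto w = y
    have h3 : w = y - z := eq_sub_of_add_eq h
    rw [h3, map_sub, Submodule.orthogonalProjectionOnto_mem_subspace_eq_self,
      L.space.orthogonalProjectionOnto_eq_zero_iff.2 hz, sub_zero]
  · ext; rfl

/-- For `W ∈ Ω(Lᗮ)` the subspace `W` is the graph of `graphOp L W`. -/
lemma mem_iff_graphOp {L W : Lagrangian J} (hW : W ∈ graphDomain L) (x : H) :
    x ∈ W.space ↔ ∃ v : L.space, x = v + graphOp L W v := by
  have hinv := isInvertible_proj₀ hW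
  have key : ∀ v : L.space, (v : H) + graphOp L W v = (proj₀ L W).inverse v := by
    intro v
    obtain ⟨e, he⟩ := hinv
    have hv : proj₀ L W ((proj₀ L W).inverse v) = v := by
      rw [← he, ContinuousLinearMap.inverse_equiv]
      exact e.apply_symm_apply v
    set w := (proj₀ L W).inverse v with hw
    have h0 : (v : H) = L.space.starProjection w := by
      rw [← hv]; rfl
    have h1 : ((graphOp L W v : L.spaceᗮ) : H) = L.spaceᗮ.starProjection w := rfl
    rw [h0, h1, Submodule.starProjection_add_starProjection_orthogonal]
  constructor
  · intro hx
    refine ⟨proj₀ L W ⟨x, hx⟩, ?_⟩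
    rw [key]
    obtain ⟨e, he⟩ := hinv
    rw [← he, ContinuousLinearMap.inverse_equiv]
    exact (congrArg Subtype.val (e.symm_apply_apply ⟨x, hx⟩)).symm
  · rintro ⟨v, rfl⟩
    rw [key]
    exact Subtype.mem _

end Lagrangian

end

/-! ### Manifolds from a family of charts with values in isomorphic normed spaces -/

section ManifoldOfCharts

/-! Write P for the orthogonal projection onto L, P' for that onto L'. A Lagrangian W complementary
to Lᗮ is the range of G_ψ v = v - Jψv with ψ = φ_L(W), and isotropy of W is exactly symmetry of ψ.
Conversely, for symmetric ψ the range of G_ψ is Lagrangian. So φ_L is a bijection onto B(L)_s.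

The chart is characterized by φ_{L'}(W)(P'x) = P'Jx for x in W. Putting x = G_ψ v gives the
transition map ψ ↦ (P'J G_ψ)(P' G_ψ)⁻¹ (`Lagrangian.graphChart_graph_comp`). It is defined where P'
G_ψ is invertible, an open condition, and is smooth because inversion of operators is smooth.

On the orbit, write L = h(L') with h - 1 Hilbert-Schmidt. As P'J kills L', the operator P'J|_L is
Hilbert-Schmidt. Hence P'J G_ψ = P'J|_L + P'ψ is affine in ψ with Hilbert-Schmidt values, and since
composition is continuous for the 2-norm, the transition maps are smooth for that norm too. The same
cancellation shows that φ_L(W) is Hilbert-Schmidt for W in the orbit of L. Conversely, the shear 1 -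
JψP lies in Sp₂ and carries L to the range of G_ψ when ψ is symmetric Hilbert-Schmidt.

In the charts centred at one point of the orbit, the inclusion is the linear injection B₂(L)_s →
B(L)_s, bounded since the operator norm is at most the 2-norm; this gives the immersion.

The charts take values in spaces that vary with L, whereas a charted space has one model. All
Lagrangians are isomorphic (`Lagrangian.nonempty_equiv`), so the spaces can be identified with those
over L₀, and `exists_manifold_of_charts` glues. -/

theorem exists_manifold_of_charts {M ι E : Type*} [NormedAddCommGroup E] [NormedSpace ℝ E]
    {F : ι → Type*} [∀ i, NormedAddCommGroup (F i)] [∀ i, NormedSpace ℝ (F i)]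
    (φ : ∀ i, PartialEquiv M (F i)) (Φ : ∀ i, F i ≃L[ℝ] E)
    (htarget : ∀ i, (φ i).target = univ) (hcover : ∀ x, ∃ i, x ∈ (φ i).source)
    (hopen : ∀ i j, IsOpen ((φ i).symm ⁻¹' (φ j).source))
    (hsmooth : ∀ i j, ContDiffOn ℝ ∞ (φ j ∘ (φ i).symm) ((φ i).symm ⁻¹' (φ j).source)) :
    ∃ (_ : TopologicalSpace M) (_ : ChartedSpace E M), IsManifold 𝓘(ℝ, E) ∞ M ∧
      ∀ i, ∃ e : OpenPartialHomeomorph M (F i), e.toPartialEquiv = φ i ∧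
        ContMDiffOn 𝓘(ℝ, E) 𝓘(ℝ, F i) ∞ e e.source ∧
        ContMDiffOn 𝓘(ℝ, F i) 𝓘(ℝ, E) ∞ e.symm e.target := by
  -- All charts are moved into the common model E.
  let ψ : ∀ i, PartialEquiv M E := fun i => (φ i).transEquiv (Φ i).toEquiv
  have hψt : ∀ i, (ψ i).target = univ := fun i => by
    change (Φ i).symm ⁻¹' (φ i).target = univ
    rw [htarget, preimage_univ]
  have hsource : ∀ i j, ((ψ i).symm.trans (ψ j)).source =
      (Φ i).symm ⁻¹' ((φ i).symm ⁻¹' (φ j).source) := fun i j => by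
    rw [PartialEquiv.trans_source, PartialEquiv.symm_source, hψt, univ_inter]
    rfl
  have hsm : ∀ i j, ContDiffOn ℝ ∞ ((ψ i).symm.trans (ψ j)) ((ψ i).symm.trans (ψ j)).source := by
    intro i j
    rw [hsource]
    exact (Φ j).contDiff.comp_contDiffOn
      ((hsmooth i j).comp (Φ i).symm.contDiff.contDiffOn fun x hx => hx)
  choose k hk using hcover
  let c : ChartedSpaceCore E M :=
    { atlas := range ψ
      chartAt := fun x => ψ (k x)
      mem_chart_source := fun x => hk x
      chart_mem_atlas := fun x => mem_range_self _
      open_source := by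
        rintro _ _ ⟨i, rfl⟩ ⟨j, rfl⟩
        rw [hsource]
        exact (hopen i j).preimage (Φ i).symm.continuous
      continuousOn_toFun := by
        rintro _ _ ⟨i, rfl⟩ ⟨j, rfl⟩
        exact (hsm i j).continuousOn }
  -- M has no topology beforehand; the charts generate it.
  let tM : TopologicalSpace M := c.toTopologicalSpace
  let cM : ChartedSpace E M := c.toChartedSpace
  have hatlas : ∀ e, e ∈ atlas E M ↔ ∃ i, e = c.openPartialHomeomorph (ψ i) (mem_range_self i) := by
    intro e
    constructor
    · intro he
      obtain ⟨_, ⟨e', rfl⟩, _, ⟨⟨i, rfl⟩, rfl⟩, he'⟩ := he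
      exact ⟨i, he'⟩
    · rintro ⟨i, rfl⟩
      exact mem_iUnion₂.2 ⟨ψ i, mem_range_self i, rfl⟩
  have hM : IsManifold 𝓘(ℝ, E) ∞ M := by
    refine isManifold_of_contDiffOn _ _ _ fun e e' he he' => ?_
    obtain ⟨i, rfl⟩ := (hatlas e).1 he
    obtain ⟨j, rfl⟩ := (hatlas e').1 he'
    refine (hsm i j).mono ?_
    intro x hx
    exact hx.1
  refine ⟨tM, cM, hM, fun i => ?_⟩
  set e := c.openPartialHomeomorph (ψ i) (mem_range_self i) with he
  have hmem : e ∈ IsManifold.maximalAtlas 𝓘(ℝ, E) ∞ M :=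
    IsManifold.subset_maximalAtlas ((hatlas e).2 ⟨i, rfl⟩)
  -- Undoing Φ i recovers the given chart with its own target space.
  refine ⟨e.transHomeomorph (Φ i).symm.toHomeomorph, ?_, ?_, ?_⟩
  · refine PartialEquiv.ext (fun x => ?_) (fun y => ?_) rfl
    · exact (Φ i).symm_apply_apply (φ i x)
    · exact congrArg (φ i).symm ((Φ i).symm_apply_apply y)
  · exact (Φ i).symm.contDiff.contMDiff.comp_contMDiffOn (contMDiffOn_of_mem_maximalAtlas hmem)
  · exact (contMDiffOn_symm_of_mem_maximalAtlas hmem).comp (Φ i).contDiff.contMDiff.contMDiffOn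
      fun x hx => by rw [mem_preimage, show e.target = univ from hψt i]; trivial

variable {E F E' F' M N : Type*} [NormedAddCommGroup E] [NormedSpace ℝ E]
  [NormedAddCommGroup F] [NormedSpace ℝ F] [NormedAddCommGroup E'] [NormedSpace ℝ E']
  [NormedAddCommGroup F'] [NormedSpace ℝ F']
  [TopologicalSpace M] [ChartedSpace E M] [TopologicalSpace N] [ChartedSpace E' N]

/-- A map which in suitable charts is an injective continuous linear map is an immersion. -/
theorem contMDiffAt_and_injective_mfderiv_of_charts {f : M → N} {x : M}
    (e : OpenPartialHomeomorph M F) (hx : x ∈ e.source)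
    (he : ContMDiffOn 𝓘(ℝ, E) 𝓘(ℝ, F) ∞ e e.source)
    (hes : ContMDiffOn 𝓘(ℝ, F) 𝓘(ℝ, E) ∞ e.symm e.target)
    (e' : OpenPartialHomeomorph N F') (hf : ∀ y ∈ e.source, f y ∈ e'.source)
    (he' : ContMDiffOn 𝓘(ℝ, E') 𝓘(ℝ, F') ∞ e' e'.source)
    (hes' : ContMDiffOn 𝓘(ℝ, F') 𝓘(ℝ, E') ∞ e'.symm e'.target)
    (A : F →L[ℝ] F') (hA : Function.Injective A) (h : ∀ y ∈ e.source, e' (f y) = A (e y)) :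
    ContMDiffAt 𝓘(ℝ, E) 𝓘(ℝ, E') ∞ f x ∧
      Function.Injective (mfderiv 𝓘(ℝ, E) 𝓘(ℝ, E') f x) := by
  have hnhds : e.source ∈ 𝓝 x := e.open_source.mem_nhds hx
  have heAt : ContMDiffAt 𝓘(ℝ, E) 𝓘(ℝ, F) ∞ e x := he.contMDiffAt hnhds
  have hAe : ContMDiffAt 𝓘(ℝ, E) 𝓘(ℝ, F') ∞ (A ∘ e) x :=
    A.contDiff.contMDiff.contMDiffAt.comp x heAt
  have hfx : ContMDiffAt 𝓘(ℝ, E) 𝓘(ℝ, E') ∞ f x := by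
    have h1 : ContMDiffAt 𝓘(ℝ, F') 𝓘(ℝ, E') ∞ e'.symm ((A ∘ e) x) := by
      refine hes'.contMDiffAt (e'.open_target.mem_nhds ?_)
      rw [Function.comp_apply, ← h x hx]
      exact e'.map_source (hf x hx)
    refine (h1.comp x hAe).congr_of_eventuallyEq ?_
    filter_upwards [hnhds] with y hy
    rw [Function.comp_apply, Function.comp_apply, ← h y hy, e'.left_inv (hf y hy)]
  refine ⟨hfx, ?_⟩
  have htop : (∞ : ℕ∞ω) ≠ 0 := by simp
  have hde := heAt.mdifferentiableAt htop
  have hdes : MDifferentiableAt 𝓘(ℝ, F) 𝓘(ℝ, E) e.symm (e x) :=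
    (hes.contMDiffAt (e.open_target.mem_nhds (e.map_source hx))).mdifferentiableAt htop
  have hde' : MDifferentiableAt 𝓘(ℝ, E') 𝓘(ℝ, F') e' (f x) :=
    (he'.contMDiffAt (e'.open_source.mem_nhds (hf x hx))).mdifferentiableAt htop
  -- The differential of `e.symm` is a left inverse of that of `e`.
  have hinj : Function.Injective (mfderiv 𝓘(ℝ, E) 𝓘(ℝ, F) e x) := by
    have h2 : mfderiv 𝓘(ℝ, E) 𝓘(ℝ, E) (e.symm ∘ e) x = ContinuousLinearMap.id ℝ _ := by
      rw [← mfderiv_id]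
      apply Filter.EventuallyEq.mfderiv_eq
      filter_upwards [hnhds] with y hy using e.left_inv hy
    rw [mfderiv_comp x hdes hde] at h2
    intro v w hvw
    have h3 := congrArg (fun T => T v) h2
    have h4 := congrArg (fun T => T w) h2
    exact h3.symm.trans (Eq.trans (congrArg (mfderiv 𝓘(ℝ, F) 𝓘(ℝ, E) e.symm (e x)) hvw) h4)
  -- By the chain rule de' ∘ df = A ∘ de. The right side is injective, hence so is df.
  have h5 : mfderiv 𝓘(ℝ, E) 𝓘(ℝ, F') (e' ∘ f) x =
      A ∘L (mfderiv 𝓘(ℝ, E) 𝓘(ℝ, F) e x : E →L[ℝ] F) := by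
    have h6 : mfderiv 𝓘(ℝ, E) 𝓘(ℝ, F') (e' ∘ f) x = mfderiv 𝓘(ℝ, E) 𝓘(ℝ, F') (A ∘ e) x := by
      apply Filter.EventuallyEq.mfderiv_eq
      filter_upwards [hnhds] with y hy using h y hy
    rw [h6, mfderiv_comp x A.differentiableAt.mdifferentiableAt hde, mfderiv_eq_fderiv,
      A.fderiv]
    rfl
  rw [mfderiv_comp x hde' (hfx.mdifferentiableAt htop)] at h5
  intro v w hvw
  refine hinj (hA ?_)
  have h7 := congrArg (fun T => T v) h5
  have h8 := congrArg (fun T => T w) h5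
  refine h7.symm.trans (Eq.trans ?_ h8)
  exact congrArg (mfderiv 𝓘(ℝ, E') 𝓘(ℝ, F') e' (f x)) hvw

end ManifoldOfCharts

/-! ### The Hilbert-Schmidt norm -/

section HilbertSchmidtNorm

variable {D E F G : Type*}
  [NormedAddCommGroup D] [InnerProductSpace ℝ D] [CompleteSpace D]
  [NormedAddCommGroup E] [InnerProductSpace ℝ E] [CompleteSpace E]
  [NormedAddCommGroup F] [InnerProductSpace ℝ F] [CompleteSpace F]
  [NormedAddCommGroup G] [InnerProductSpace ℝ G] [CompleteSpace G]

open ContinuousLinearMap (adjoint)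

/-- The square of the Hilbert-Schmidt norm, with value `⊤` on the other operators. -/
noncomputable def hsNormSq (a : E →L[ℝ] F) : ENNReal :=
  ∑' i, ENNReal.ofReal (‖a (stdHilbertBasis E i)‖ ^ 2)

omit [CompleteSpace F] in
lemma isHilbertSchmidt_iff_hsNormSq_ne_top {a : E →L[ℝ] F} :
    IsHilbertSchmidt a ↔ hsNormSq a ≠ ⊤ :=
  summable_iff_tsum_ofReal_ne_top _ fun _ => sq_nonneg _

lemma hsNormSq_adjoint (a : E →L[ℝ] F) : hsNormSq (adjoint a) = hsNormSq a :=
  (tsum_norm_sq_adjoint _ _ a).symm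

omit [CompleteSpace F] [CompleteSpace G] in
lemma hsNormSq_comp_left_le (A : F →L[ℝ] G) (a : E →L[ℝ] F) :
    hsNormSq (A ∘L a) ≤ ENNReal.ofReal (‖A‖ ^ 2) * hsNormSq a := by
  rw [hsNormSq, hsNormSq, ← ENNReal.tsum_mul_left]
  refine ENNReal.tsum_le_tsum fun i => ?_
  rw [← ENNReal.ofReal_mul (sq_nonneg _), ← mul_pow]
  exact ENNReal.ofReal_le_ofReal (pow_le_pow_left₀ (norm_nonneg _) (A.le_opNorm _) 2)

/-- Taking adjoints turns right composition into left composition and preserves both norms. -/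
lemma hsNormSq_comp_right_le (a : E →L[ℝ] F) (A : D →L[ℝ] E) :
    hsNormSq (a ∘L A) ≤ ENNReal.ofReal (‖A‖ ^ 2) * hsNormSq a := by
  rw [← hsNormSq_adjoint, ContinuousLinearMap.adjoint_comp, ← hsNormSq_adjoint a,
    ← LinearIsometryEquiv.norm_map adjoint A]
  exact hsNormSq_comp_left_le _ _

/-- Parseval in a basis (c_j) of F gives ‖a x‖² = ∑ ⟪a* c_j, x⟫²; Cauchy-Schwarz bounds each term.
This is why the operator norm is at most the 2-norm. -/
lemma ofReal_norm_apply_sq_le (a : E →L[ℝ] F) (x : E) :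
    ENNReal.ofReal (‖a x‖ ^ 2) ≤ ENNReal.ofReal (‖x‖ ^ 2) * hsNormSq a := by
  rw [← hsNormSq_adjoint, hsNormSq, ← ENNReal.tsum_mul_left,
    ← (stdHilbertBasis F).tsum_ofReal_inner_sq]
  refine ENNReal.tsum_le_tsum fun j => ?_
  rw [← ENNReal.ofReal_mul (sq_nonneg _), ← ContinuousLinearMap.adjoint_inner_left, ← mul_pow,
    ← sq_abs, mul_comm]
  exact ENNReal.ofReal_le_ofReal (pow_le_pow_left₀ (abs_nonneg _) (abs_real_inner_le_norm _ _) 2)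

omit [CompleteSpace F] [CompleteSpace G] in
lemma IsHilbertSchmidt.comp_left {a : E →L[ℝ] F} (ha : IsHilbertSchmidt a) (A : F →L[ℝ] G) :
    IsHilbertSchmidt (A ∘L a) :=
  isHilbertSchmidt_iff_hsNormSq_ne_top.2 (ne_top_of_le_ne_top (ENNReal.mul_ne_top
    ENNReal.ofReal_ne_top (isHilbertSchmidt_iff_hsNormSq_ne_top.1 ha)) (hsNormSq_comp_left_le A a))

lemma IsHilbertSchmidt.comp_right {a : E →L[ℝ] F} (ha : IsHilbertSchmidt a) (A : D →L[ℝ] E) :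
    IsHilbertSchmidt (a ∘L A) :=
  isHilbertSchmidt_iff_hsNormSq_ne_top.2 (ne_top_of_le_ne_top (ENNReal.mul_ne_top
    ENNReal.ofReal_ne_top (isHilbertSchmidt_iff_hsNormSq_ne_top.1 ha)) (hsNormSq_comp_right_le a A))

lemma IsHilbertSchmidt.adjoint {a : E →L[ℝ] F} (ha : IsHilbertSchmidt a) :
    IsHilbertSchmidt (ContinuousLinearMap.adjoint a) := by
  rwa [isHilbertSchmidt_iff_hsNormSq_ne_top, hsNormSq_adjoint,
    ← isHilbertSchmidt_iff_hsNormSq_ne_top]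

omit [CompleteSpace F] in
lemma IsHilbertSchmidt.add {a b : E →L[ℝ] F} (ha : IsHilbertSchmidt a) (hb : IsHilbertSchmidt b) :
    IsHilbertSchmidt (a + b) :=
  (isHilbertSchmidt_iff_memℓp _).2
    (((isHilbertSchmidt_iff_memℓp a).1 ha).add ((isHilbertSchmidt_iff_memℓp b).1 hb))

omit [CompleteSpace F] in
lemma IsHilbertSchmidt.const_smul {a : E →L[ℝ] F} (ha : IsHilbertSchmidt a) (r : ℝ) :
    IsHilbertSchmidt (r • a) := by
  simpa [IsHilbertSchmidt, norm_smul, mul_pow] using Summable.mul_left (r ^ 2) ha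

omit [CompleteSpace F] in
lemma IsHilbertSchmidt.neg {a : E →L[ℝ] F} (ha : IsHilbertSchmidt a) :
    IsHilbertSchmidt (-a) := by
  simpa using ha.const_smul (-1)

variable (E F) in
/-- The Hilbert-Schmidt operators as a linear subspace of the bounded operators. -/
def hsSubmodule : Submodule ℝ (E →L[ℝ] F) where
  carrier := {a | IsHilbertSchmidt a}
  add_mem' ha hb := ha.add hb
  zero_mem' := by simp [IsHilbertSchmidt, summable_zero]
  smul_mem' r _ ha := IsHilbertSchmidt.const_smul ha r

variable (E F) in
/-- The space of Hilbert-Schmidt operators with the Hilbert-Schmidt norm. -/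
def HSOp : Type _ := hsSubmodule E F

namespace HSOp

instance : AddCommGroup (HSOp E F) := inferInstanceAs (AddCommGroup (hsSubmodule E F))

instance : Module ℝ (HSOp E F) := inferInstanceAs (Module ℝ (hsSubmodule E F))

/-- The underlying bounded operator. -/
def toCLM (a : HSOp E F) : E →L[ℝ] F := Subtype.val (p := fun x => x ∈ hsSubmodule E F) a

omit [CompleteSpace F] in
lemma isHilbertSchmidt (a : HSOp E F) : IsHilbertSchmidt a.toCLM := a.2

omit [CompleteSpace F] in
@[ext]
lemma ext {a b : HSOp E F} (h : a.toCLM = b.toCLM) : a = b := Subtype.ext h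

variable (E F) in
/-- The linear map `a ↦ (a e_i)_i` into the Hilbert sum `ℓ²(F)`. -/
noncomputable def toLp : HSOp E F →ₗ[ℝ] lp (fun _ : stdIndex E => F) 2 where
  toFun a := ⟨fun i => a.toCLM (stdHilbertBasis E i), (isHilbertSchmidt_iff_memℓp _).1 a.2⟩
  map_add' _ _ := rfl
  map_smul' _ _ := rfl

omit [CompleteSpace F] in
lemma toLp_injective : Function.Injective (toLp E F) := by
  intro a b h
  refine Subtype.ext (ContinuousLinearMap.ext_on
    (Submodule.dense_iff_topologicalClosure_eq_top.2 (stdHilbertBasis E).dense_span) ?_)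
  rintro _ ⟨i, rfl⟩
  exact congrFun (congrArg Subtype.val h) i

noncomputable instance : NormedAddCommGroup (HSOp E F) :=
  NormedAddCommGroup.induced (HSOp E F) (lp (fun _ : stdIndex E => F) 2) (toLp E F) toLp_injective

noncomputable instance : NormedSpace ℝ (HSOp E F) :=
  NormedSpace.induced ℝ (HSOp E F) (lp (fun _ : stdIndex E => F) 2) (toLp E F)

omit [CompleteSpace F] in
lemma hsNormSq_toCLM (a : HSOp E F) : hsNormSq a.toCLM = ENNReal.ofReal (‖a‖ ^ 2) := by
  have h := lp.norm_rpow_eq_tsum (p := 2) (by norm_num) (toLp E F a)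
  have hsum := lp.memℓp (toLp E F a)
  rw [memℓp_gen_iff (by norm_num)] at hsum
  simp only [ENNReal.toReal_ofNat, Real.rpow_ofNat] at h hsum
  rw [show ‖a‖ = ‖toLp E F a‖ from rfl, h, ENNReal.ofReal_tsum_of_nonneg (fun _ => sq_nonneg _) hsum]
  rfl

omit [CompleteSpace E] [CompleteSpace G] in
lemma norm_le_of_hsNormSq_le {a : HSOp D E} {b : HSOp F G} {C : ℝ} (hC : 0 ≤ C)
    (h : hsNormSq a.toCLM ≤ ENNReal.ofReal (C ^ 2) * hsNormSq b.toCLM) : ‖a‖ ≤ C * ‖b‖ := by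
  rw [hsNormSq_toCLM, hsNormSq_toCLM, ← ENNReal.ofReal_mul (sq_nonneg _), ← mul_pow,
    ENNReal.ofReal_le_ofReal_iff (sq_nonneg _)] at h
  exact le_of_sq_le_sq h (by positivity)

lemma norm_toCLM_le (a : HSOp E F) : ‖a.toCLM‖ ≤ ‖a‖ := by
  refine a.toCLM.opNorm_le_bound (norm_nonneg _) fun x => ?_
  have h := ofReal_norm_apply_sq_le a.toCLM x
  rw [hsNormSq_toCLM, ← ENNReal.ofReal_mul (sq_nonneg _), ← mul_pow,
    ENNReal.ofReal_le_ofReal_iff (sq_nonneg _), mul_comm] at h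
  exact le_of_sq_le_sq h (by positivity)

variable (E F) in
/-- The inclusion of the Hilbert-Schmidt operators into the bounded operators. -/
noncomputable def toCLMₗ : HSOp E F →L[ℝ] (E →L[ℝ] F) :=
  LinearMap.mkContinuous (hsSubmodule E F).subtype 1 fun a => by
    rw [one_mul]; exact norm_toCLM_le a

/-- Composition `(A, a) ↦ A ∘ a` of a bounded and a Hilbert-Schmidt operator. -/
noncomputable def compLeft : (F →L[ℝ] G) →L[ℝ] HSOp E F →L[ℝ] HSOp E G :=
  LinearMap.mkContinuous₂
    (LinearMap.mk₂ ℝ (fun A a => (⟨A ∘L a.toCLM, a.isHilbertSchmidt.comp_left A⟩ : HSOp E G))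
      (fun _ _ _ => rfl) (fun _ _ _ => rfl)
      (fun A _ _ => HSOp.ext (ContinuousLinearMap.comp_add A _ _))
      (fun r A _ => HSOp.ext (A.comp_smul r _)))
    1 fun A a => by
      rw [one_mul]
      exact norm_le_of_hsNormSq_le (norm_nonneg A) (hsNormSq_comp_left_le A a.toCLM)

/-- Composition `(A, a) ↦ a ∘ A` of a bounded and a Hilbert-Schmidt operator. -/
noncomputable def compRight : (D →L[ℝ] E) →L[ℝ] HSOp E F →L[ℝ] HSOp D F :=
  LinearMap.mkContinuous₂
    (LinearMap.mk₂ ℝ (fun A a => (⟨a.toCLM ∘L A, a.isHilbertSchmidt.comp_right A⟩ : HSOp D F))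
      (fun _ _ a => HSOp.ext (ContinuousLinearMap.comp_add a.toCLM _ _))
      (fun r A a => HSOp.ext (a.toCLM.comp_smul r A))
      (fun _ _ _ => rfl) (fun _ _ _ => rfl))
    1 fun A a => by
      rw [one_mul]
      exact norm_le_of_hsNormSq_le (norm_nonneg A) (hsNormSq_comp_right_le a.toCLM A)

/-- The symmetric part of a Hilbert-Schmidt operator. -/
noncomputable def symPart : HSOp E E →L[ℝ] HSSym E :=
  LinearMap.mkContinuous
    { toFun := fun a => (⟨(1 / 2 : ℝ) • (a.toCLM + adjoint a.toCLM),
        IsSelfAdjoint.smul (IsSelfAdjoint.all _) (IsSelfAdjoint.add_star_self a.toCLM),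
        (a.isHilbertSchmidt.add a.isHilbertSchmidt.adjoint).const_smul _⟩ : HSSym E)
      map_add' := fun a b => Subtype.ext (by
        change (1 / 2 : ℝ) • (a.toCLM + b.toCLM + adjoint (a.toCLM + b.toCLM)) =
          (1 / 2 : ℝ) • (a.toCLM + adjoint a.toCLM) + (1 / 2 : ℝ) • (b.toCLM + adjoint b.toCLM)
        rw [map_add]
        module)
      map_smul' := fun r a => Subtype.ext (by
        change (1 / 2 : ℝ) • (r • a.toCLM + adjoint (r • a.toCLM)) =
          r • (1 / 2 : ℝ) • (a.toCLM + adjoint a.toCLM)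
        rw [LinearIsometryEquiv.map_smulₛₗ]
        simp only [conj_trivial]
        module) } 1 fun a => by
    -- The adjoint has the same 2-norm, so averaging a with it does not increase the norm.
    let b : HSOp E E := ⟨adjoint a.toCLM, a.isHilbertSchmidt.adjoint⟩
    have hb : ‖b‖ ≤ 1 * ‖a‖ := norm_le_of_hsNormSq_le zero_le_one (by
      rw [one_pow, ENNReal.ofReal_one, one_mul]
      exact (hsNormSq_adjoint a.toCLM).le)
    calc _ = ‖(1 / 2 : ℝ) • (a + b)‖ := rfl
      _ ≤ 1 * ‖a‖ := by
        rw [norm_smul, Real.norm_of_nonneg (by norm_num)]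
        linarith [norm_add_le a b]

end HSOp

namespace HSSym

variable (E) in
/-- The inclusion of the symmetric Hilbert-Schmidt operators into all of them. -/
noncomputable def toHSOp : HSSym E →L[ℝ] HSOp E E :=
  LinearMap.mkContinuous
    { toFun := fun a => (⟨a.toCLM, a.2.2⟩ : HSOp E E)
      map_add' := fun _ _ => rfl
      map_smul' := fun _ _ => rfl } 1 fun a => by rw [one_mul]; exact le_rfl

lemma isSelfAdjoint (a : HSSym E) : IsSelfAdjoint a.toCLM := a.2.1

@[ext]
lemma ext {a b : HSSym E} (h : a.toCLM = b.toCLM) : a = b := Subtype.ext h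

variable (E) in
/-- The inclusion of the symmetric Hilbert-Schmidt operators into the symmetric operators. -/
noncomputable def toSymOp : HSSym E →L[ℝ] SymOp E :=
  (HSOp.toCLMₗ E E ∘L toHSOp E).codRestrict _ fun a => a.isSelfAdjoint

end HSSym

namespace HSOp

lemma toCLM_symPart (a : HSOp E E) (ha : IsSelfAdjoint a.toCLM) : (symPart a).toCLM = a.toCLM := by
  change (1 / 2 : ℝ) • (a.toCLM + adjoint a.toCLM) = a.toCLM
  rw [ContinuousLinearMap.isSelfAdjoint_iff'.1 ha]
  module

end HSOp

/-! ### Symmetric parts and conjugation -/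

namespace SymOp

variable (E) in
/-- The symmetric part of a bounded operator. -/
noncomputable def symPart : (E →L[ℝ] E) →L[ℝ] SymOp E :=
  LinearMap.mkContinuous
    { toFun := fun a => (⟨(1 / 2 : ℝ) • (a + adjoint a),
        IsSelfAdjoint.smul (IsSelfAdjoint.all _) (IsSelfAdjoint.add_star_self a)⟩ : SymOp E)
      map_add' := fun a b => Subtype.ext (by
        change (1 / 2 : ℝ) • (a + b + adjoint (a + b)) =
          (1 / 2 : ℝ) • (a + adjoint a) + (1 / 2 : ℝ) • (b + adjoint b)
        rw [map_add]
        module)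
      map_smul' := fun r a => Subtype.ext (by
        change (1 / 2 : ℝ) • (r • a + adjoint (r • a)) = r • (1 / 2 : ℝ) • (a + adjoint a)
        rw [LinearIsometryEquiv.map_smulₛₗ]
        simp only [conj_trivial]
        module) } 1 fun a => by
    calc _ = ‖(1 / 2 : ℝ) • (a + adjoint a)‖ := rfl
      _ ≤ 1 * ‖a‖ := by
        rw [norm_smul, Real.norm_of_nonneg (by norm_num)]
        linarith [norm_add_le a (adjoint a), LinearIsometryEquiv.norm_map adjoint a]

lemma coe_symPart (a : E →L[ℝ] E) (ha : IsSelfAdjoint a) : (symPart E a : E →L[ℝ] E) = a := by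
  change (1 / 2 : ℝ) • (a + adjoint a) = a
  rw [ContinuousLinearMap.isSelfAdjoint_iff'.1 ha]
  module

/-- The conjugation `ψ ↦ S ψ S*` on symmetric operators. -/
noncomputable def conj (S : E →L[ℝ] F) : SymOp E →L[ℝ] SymOp F :=
  symPart F ∘L (ContinuousLinearMap.compL ℝ F E F).flip (adjoint S) ∘L
    (ContinuousLinearMap.compL ℝ E E F S) ∘L (selfAdjoint.submodule ℝ (E →L[ℝ] E)).subtypeL

lemma coe_conj (S : E →L[ℝ] F) (ψ : SymOp E) :
    (conj S ψ : F →L[ℝ] F) = (S ∘L (ψ : E →L[ℝ] E)) ∘L adjoint S :=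
  coe_symPart _ (IsSelfAdjoint.conj_adjoint ψ.2 S)

end SymOp

namespace HSSym

/-- The conjugation `ψ ↦ S ψ S*` on symmetric Hilbert-Schmidt operators. -/
noncomputable def conj (S : E →L[ℝ] F) : HSSym E →L[ℝ] HSSym F :=
  HSOp.symPart ∘L HSOp.compRight (adjoint S) ∘L HSOp.compLeft S ∘L toHSOp E

lemma toCLM_conj (S : E →L[ℝ] F) (ψ : HSSym E) :
    (conj S ψ).toCLM = (S ∘L ψ.toCLM) ∘L adjoint S :=
  HSOp.toCLM_symPart _ (IsSelfAdjoint.conj_adjoint ψ.isSelfAdjoint S)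

end HSSym

/-- Conjugation uses S* instead of S⁻¹ because this preserves symmetry even if S is not isometric;
it is still inverted by conjugation with S⁻¹. -/
lemma comp_conj_cancel {S : E →L[ℝ] F} {T : F →L[ℝ] E} (h : T ∘L S = ContinuousLinearMap.id ℝ E)
    (a : E →L[ℝ] E) : (T ∘L ((S ∘L a) ∘L adjoint S)) ∘L adjoint T = a := by
  have h' : adjoint S ∘L adjoint T = ContinuousLinearMap.id ℝ E := by
    rw [← ContinuousLinearMap.adjoint_comp, h, ContinuousLinearMap.adjoint_id]
  calc _ = (T ∘L S) ∘L a ∘L (adjoint S ∘L adjoint T) := rfl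
    _ = a := by rw [h, h']; rfl

/-- Isomorphic Hilbert spaces have isomorphic spaces of symmetric operators. -/
noncomputable def SymOp.congr (S : E ≃L[ℝ] F) : SymOp E ≃L[ℝ] SymOp F :=
  ContinuousLinearEquiv.equivOfInverse (SymOp.conj (S : E →L[ℝ] F))
    (SymOp.conj (S.symm : F →L[ℝ] E))
    (fun a => Subtype.ext (by
      rw [SymOp.coe_conj, SymOp.coe_conj]
      exact comp_conj_cancel S.coe_symm_comp_coe _))
    (fun a => Subtype.ext (by
      rw [SymOp.coe_conj, SymOp.coe_conj]
      exact comp_conj_cancel S.coe_comp_coe_symm _))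

/-- Isomorphic Hilbert spaces have isomorphic spaces of symmetric Hilbert-Schmidt operators. -/
noncomputable def HSSym.congr (S : E ≃L[ℝ] F) : HSSym E ≃L[ℝ] HSSym F :=
  ContinuousLinearEquiv.equivOfInverse (HSSym.conj (S : E →L[ℝ] F))
    (HSSym.conj (S.symm : F →L[ℝ] E))
    (fun a => HSSym.ext (by
      rw [HSSym.toCLM_conj, HSSym.toCLM_conj]
      exact comp_conj_cancel S.coe_symm_comp_coe _))
    (fun a => HSSym.ext (by
      rw [HSSym.toCLM_conj, HSSym.toCLM_conj]
      exact comp_conj_cancel S.coe_comp_coe_symm _))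

end HilbertSchmidtNorm

/-! ### Lagrangian subspaces as graphs -/

section LagrangianGraphs

variable {H : Type*} [NormedAddCommGroup H] [InnerProductSpace ℝ H] [CompleteSpace H]
  {J : H →L[ℝ] H}

/-- `J` is an orthogonal complex structure: `J² = -1` and `J* = -J`. -/
structure IsComplexStructure (J : H →L[ℝ] H) : Prop where
  comp_self : J ∘L J = -ContinuousLinearMap.id ℝ H
  adjoint_eq : ContinuousLinearMap.adjoint J = -J

namespace IsComplexStructure

variable (hJ : IsComplexStructure J)
include hJ

lemma apply_apply (x : H) : J (J x) = -x :=
  congrArg (fun T : H →L[ℝ] H => T x) hJ.comp_self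

lemma inner_left (x y : H) : inner ℝ (J x) y = -inner ℝ x (J y) := by
  rw [← ContinuousLinearMap.adjoint_inner_right, hJ.adjoint_eq, neg_apply,
    inner_neg_right]

lemma inner_apply_apply (x y : H) : inner ℝ (J x) (J y) = (inner ℝ x y : ℝ) := by
  rw [hJ.inner_left, hJ.apply_apply, inner_neg_right, neg_neg]

end IsComplexStructure

namespace Lagrangian

omit [CompleteSpace H] in
lemma apply_mem_orthogonal (L : Lagrangian J) {x : H} (hx : x ∈ L.space) : J x ∈ L.spaceᗮ :=
  L.map_eq ▸ Submodule.mem_map_of_mem hx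

lemma apply_mem (hJ : IsComplexStructure J) (L : Lagrangian J) {x : H} (hx : x ∈ L.spaceᗮ) :
    J x ∈ L.space := by
  rw [← L.map_eq] at hx
  obtain ⟨y, hy, rfl⟩ := hx
  change J (J y) ∈ L.space
  rw [hJ.apply_apply]
  exact L.space.neg_mem hy

omit [CompleteSpace H] in
lemma inner_apply_left (L : Lagrangian J) {x y : H} (hx : x ∈ L.space) (hy : y ∈ L.space) :
    inner ℝ (J x) y = (0 : ℝ) :=
  (Submodule.mem_orthogonal' _ _).1 (L.apply_mem_orthogonal hx) y hy

omit [CompleteSpace H] in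
lemma inner_apply_right (L : Lagrangian J) {x y : H} (hx : x ∈ L.space) (hy : y ∈ L.space) :
    inner ℝ x (J y) = (0 : ℝ) :=
  (Submodule.mem_orthogonal _ _).1 (L.apply_mem_orthogonal hy) x hx

/-- The orthogonal projection onto `L`. -/
noncomputable abbrev proj (L : Lagrangian J) : H →L[ℝ] L.space := L.space.orthogonalProjectionOnto

lemma proj_coe (L : Lagrangian J) (v : L.space) : L.proj v = v :=
  Submodule.orthogonalProjectionOnto_mem_subspace_eq_self v

lemma proj_eq_zero (L : Lagrangian J) {x : H} (hx : x ∈ L.spaceᗮ) : L.proj x = 0 :=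
  L.space.orthogonalProjectionOnto_eq_zero_iff.2 hx

lemma proj_apply_coe (L : Lagrangian J) (v : L.space) : L.proj (J v) = 0 :=
  L.proj_eq_zero (L.apply_mem_orthogonal v.2)

lemma coe_proj_apply (hJ : IsComplexStructure J) (L : Lagrangian J) {y : H} (hy : y ∈ L.spaceᗮ) :
    (L.proj (J y) : H) = J y :=
  congrArg Subtype.val (L.proj_coe ⟨J y, L.apply_mem hJ hy⟩)

lemma inner_proj (L : Lagrangian J) (x : H) (v : L.space) :
    inner ℝ (L.proj x) v = (inner ℝ x (v : H) : ℝ) :=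
  L.space.inner_orthogonalProjectionOnto_eq_of_mem_right v x

/-- The parametrization `v ↦ v - J ψ v` of the graph of `-J ψ : L → Lᗮ`. -/
noncomputable def graphVec (L : Lagrangian J) (ψ : L.space →L[ℝ] L.space) : L.space →L[ℝ] H :=
  L.space.subtypeL - J ∘L L.space.subtypeL ∘L ψ

omit [CompleteSpace H] in
lemma graphVec_apply (L : Lagrangian J) (ψ : L.space →L[ℝ] L.space) (v : L.space) :
    L.graphVec ψ v = v - J (ψ v) := rfl

lemma apply_graphVec (hJ : IsComplexStructure J) (L : Lagrangian J) (ψ : L.space →L[ℝ] L.space)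
    (v : L.space) : J (L.graphVec ψ v) = J v + ψ v := by
  rw [graphVec_apply, map_sub, hJ.apply_apply, sub_neg_eq_add]

lemma proj_graphVec (L : Lagrangian J) (ψ : L.space →L[ℝ] L.space) (v : L.space) :
    L.proj (L.graphVec ψ v) = v := by
  rw [graphVec_apply, map_sub, L.proj_coe, L.proj_apply_coe, sub_zero]

lemma proj_apply_graphVec (hJ : IsComplexStructure J) (L : Lagrangian J)
    (ψ : L.space →L[ℝ] L.space) (v : L.space) : L.proj (J (L.graphVec ψ v)) = ψ v := by
  rw [apply_graphVec hJ, map_add, L.proj_coe, L.proj_apply_coe, zero_add]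

lemma graphVec_injective (L : Lagrangian J) (ψ : L.space →L[ℝ] L.space) :
    Function.Injective (L.graphVec ψ) := fun v w h => by
  rw [← L.proj_graphVec ψ v, h, L.proj_graphVec]

/-- The Lagrangian `φ_L⁻¹(ψ)`, the graph of `-J ψ`. -/
noncomputable def graph (hJ : IsComplexStructure J) (L : Lagrangian J) (ψ : SymOp L.space) :
    Lagrangian J where
  space := LinearMap.range (L.graphVec ψ : L.space →ₗ[ℝ] H)
  isClosed := by
    -- Since P G_ψ = 1, the range is the fixed-point set of the continuous map G_ψ P.
    have h : ((LinearMap.range (L.graphVec ψ : L.space →ₗ[ℝ] H) : Submodule ℝ H) : Set H) =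
        {x | L.graphVec ψ (L.proj x) = x} := by
      ext x
      constructor
      · rintro ⟨v, rfl⟩
        exact congrArg (L.graphVec ψ) (L.proj_graphVec ψ v)
      · intro hx
        exact ⟨L.proj x, hx⟩
    rw [h]
    exact isClosed_eq ((L.graphVec ψ).continuous.comp L.proj.continuous) continuous_id
  map_eq := by
    have hψ : ∀ u v : L.space,
        inner ℝ ((ψ : L.space →L[ℝ] L.space) u : H) (v : H) =
          (inner ℝ (u : H) ((ψ : L.space →L[ℝ] L.space) v : H) : ℝ) :=
      ContinuousLinearMap.isSelfAdjoint_iff_isSymmetric.1 ψ.2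
    ext y
    constructor
    · rintro ⟨_, ⟨v, rfl⟩, rfl⟩
      rw [Submodule.mem_orthogonal']
      rintro _ ⟨u, rfl⟩
      change inner ℝ (J (L.graphVec ψ v)) (L.graphVec ψ u) = (0 : ℝ)
      rw [apply_graphVec hJ, graphVec_apply, inner_sub_right, inner_add_left, inner_add_left,
        L.inner_apply_left v.2 u.2, hJ.inner_apply_apply,
        L.inner_apply_right (Subtype.mem _) (Subtype.mem _), hψ]
      ring
    · intro hy
      rw [Submodule.mem_orthogonal'] at hy
      obtain ⟨z, hyz⟩ : ∃ z, J z = y :=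
        ⟨-J y, by rw [map_neg, hJ.apply_apply, neg_neg]⟩
      refine ⟨z, ⟨L.proj z, ?_⟩, hyz⟩
      -- Decompose z = Pz + Jt with t in L, so y = Jz = JPz - t. Orthogonality of y to every G_ψ u
      -- forces t = -ψPz, that is z = G_ψ(Pz).
      obtain ⟨t, ht, htz⟩ : ∃ t ∈ L.space, J t = z - L.proj z := by
        have h1 : z - L.proj z ∈ L.spaceᗮ := L.space.sub_starProjection_mem_orthogonal z
        rw [← L.map_eq] at h1
        exact h1
      have key : (⟨t, ht⟩ : L.space) = -(ψ : L.space →L[ℝ] L.space) (L.proj z) := by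
        refine ext_inner_right ℝ fun u => ?_
        have h2 : inner ℝ y (L.graphVec ψ u) = (0 : ℝ) := hy _ ⟨u, rfl⟩
        have h3 : y = J (L.proj z) - t := by
          rw [← hyz, ← neg_eq_iff_eq_neg.2 (hJ.apply_apply t), htz, map_sub]
          abel
        rw [h3, graphVec_apply, inner_sub_right, inner_sub_left, inner_sub_left,
          L.inner_apply_left (Subtype.mem _) u.2, hJ.inner_apply_apply,
          L.inner_apply_right ht (Subtype.mem _)] at h2
        rw [inner_neg_left]
        change inner ℝ t (u : H) = -inner ℝ ((ψ : L.space →L[ℝ] L.space) (L.proj z) : H) (u : H)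
        rw [hψ]
        linarith
      change (L.proj z : H) - J ((ψ : L.space →L[ℝ] L.space) (L.proj z)) = z
      have h4 : (((ψ : L.space →L[ℝ] L.space) (L.proj z) : L.space) : H) = -t := by
        rw [eq_neg_iff_add_eq_zero, add_comm, ← eq_neg_iff_add_eq_zero]
        exact congrArg Subtype.val key
      rw [h4, map_neg, htz]
      abel

variable {E : Type*} [NormedAddCommGroup E] [NormedSpace ℝ E]

/-- The kernel of P is Lᗮ: injectivity of PS means W ∩ Lᗮ = 0, surjectivity means W + Lᗮ = H. -/
lemma mem_graphDomain_iff_bijective {L W : Lagrangian J} {S : E →L[ℝ] H}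
    (hS : Function.Injective S) (hW : W.space = LinearMap.range (S : E →ₗ[ℝ] H)) :
    W ∈ graphDomain L ↔ Function.Bijective (L.proj ∘L S) := by
  have hmem : ∀ v, S v ∈ W.space := fun v => hW ▸ LinearMap.mem_range_self (S : E →ₗ[ℝ] H) v
  constructor
  · intro h
    obtain ⟨hinj, hsurj⟩ := (isInvertible_proj₀ h).bijective
    constructor
    · intro u v huv
      have := @hinj ⟨S u, hmem u⟩ ⟨S v, hmem v⟩ huv
      exact hS (congrArg Subtype.val this)
    · intro y
      obtain ⟨⟨x, hx⟩, hxy⟩ := hsurj y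
      rw [hW] at hx
      obtain ⟨v, rfl⟩ := hx
      exact ⟨v, hxy⟩
  · rintro ⟨hinj, hsurj⟩
    refine ⟨Submodule.disjoint_def.2 fun x hx hx' => ?_, codisjoint_iff.2 (eq_top_iff.2 ?_)⟩
    · rw [hW] at hx
      obtain ⟨v, rfl⟩ := hx
      have : v = 0 := hinj ((L.proj_eq_zero hx').trans (map_zero (L.proj ∘L S)).symm)
      rw [this, map_zero]
    · intro y _
      obtain ⟨v, hv⟩ := hsurj (L.proj y)
      refine Submodule.mem_sup.2 ⟨S v, hmem v, y - S v, ?_, add_sub_cancel _ _⟩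
      rw [← L.space.orthogonalProjectionOnto_eq_zero_iff, map_sub, sub_eq_zero]
      exact hv.symm

lemma mem_graphDomain_iff_isInvertible [CompleteSpace E] {L W : Lagrangian J} {S : E →L[ℝ] H}
    (hS : Function.Injective S) (hW : W.space = LinearMap.range (S : E →ₗ[ℝ] H)) :
    W ∈ graphDomain L ↔ (L.proj ∘L S).IsInvertible := by
  rw [mem_graphDomain_iff_bijective hS hW]
  refine ⟨fun h => ?_, fun h => h.bijective⟩
  exact ⟨ContinuousLinearEquiv.ofBijective (L.proj ∘L S) (LinearMap.ker_eq_bot.2 h.1)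
    (LinearMap.range_eq_top.2 h.2), by ext; rfl⟩

/-- As J² = -1, the relation ψ = JT inverts to T = -Jψ. -/
lemma graphVec_graphChart (hJ : IsComplexStructure J) (L W : Lagrangian J) (v : L.space) :
    L.graphVec (graphChart L W) v = v + graphOp L W v := by
  change (v : H) - J (L.proj (J (graphOp L W v)) : H) = _
  rw [L.coe_proj_apply hJ (Subtype.mem _), hJ.apply_apply, sub_neg_eq_add]

lemma space_eq_range_graphVec (hJ : IsComplexStructure J) {L W : Lagrangian J}
    (hW : W ∈ graphDomain L) :
    W.space = LinearMap.range (L.graphVec (graphChart L W) : L.space →ₗ[ℝ] H) := by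
  ext x
  rw [mem_iff_graphOp hW, LinearMap.mem_range]
  simp only [← graphVec_graphChart hJ, eq_comm (a := x)]
  rfl

/-- The graph chart is characterized by `φ_L(W) (P x) = P J x` for `x ∈ W`. -/
lemma graphChart_proj (hJ : IsComplexStructure J) {L W : Lagrangian J} (hW : W ∈ graphDomain L)
    {x : H} (hx : x ∈ W.space) : graphChart L W (L.proj x) = L.proj (J x) := by
  rw [space_eq_range_graphVec hJ hW] at hx
  obtain ⟨v, rfl⟩ := hx
  exact (congrArg _ (L.proj_graphVec _ v)).trans (L.proj_apply_graphVec hJ _ v).symm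

/-- W is isotropic, and w(G_ψ u, G_ψ v) = ⟪ψu, v⟫ - ⟪u, ψv⟫. -/
lemma isSelfAdjoint_graphChart (hJ : IsComplexStructure J) {L W : Lagrangian J}
    (hW : W ∈ graphDomain L) : IsSelfAdjoint (graphChart L W) := by
  rw [ContinuousLinearMap.isSelfAdjoint_iff_isSymmetric]
  intro u v
  have hmem : ∀ v, L.graphVec (graphChart L W) v ∈ W.space := fun v => by
    rw [space_eq_range_graphVec hJ hW]
    exact ⟨v, rfl⟩
  have h := W.inner_apply_left (hmem u) (hmem v)
  rw [apply_graphVec hJ, graphVec_apply, inner_sub_right, inner_add_left, inner_add_left,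
    L.inner_apply_left u.2 v.2, hJ.inner_apply_apply,
    L.inner_apply_right (Subtype.mem _) (Subtype.mem _)] at h
  change inner ℝ (graphChart L W u : H) (v : H) = inner ℝ (u : H) (graphChart L W v : H)
  linarith

lemma graph_mem_graphDomain_iff (hJ : IsComplexStructure J) (L L' : Lagrangian J)
    (ψ : SymOp L.space) :
    L.graph hJ ψ ∈ graphDomain L' ↔ (L'.proj ∘L L.graphVec ψ).IsInvertible :=
  mem_graphDomain_iff_isInvertible (L.graphVec_injective ψ) rfl

lemma graph_mem_graphDomain (hJ : IsComplexStructure J) (L : Lagrangian J) (ψ : SymOp L.space) :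
    L.graph hJ ψ ∈ graphDomain L := by
  rw [graph_mem_graphDomain_iff]
  exact ⟨ContinuousLinearEquiv.refl ℝ _, ContinuousLinearMap.ext fun v =>
    (L.proj_graphVec ψ v).symm⟩

/-- The transition map in closed form: apply `graphChart_proj` to x = G_ψ v and invert P' G_ψ. -/
lemma graphChart_graph_comp (hJ : IsComplexStructure J) {L L' : Lagrangian J} {ψ : SymOp L.space}
    (h : L.graph hJ ψ ∈ graphDomain L') :
    graphChart L' (L.graph hJ ψ) =
      (L'.proj ∘L J ∘L L.graphVec ψ) ∘L (L'.proj ∘L L.graphVec ψ).inverse := by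
  have hinv := (graph_mem_graphDomain_iff hJ L L' ψ).1 h
  ext1 x
  obtain ⟨v, rfl⟩ := hinv.surjective x
  rw [ContinuousLinearMap.comp_apply _ (ContinuousLinearMap.inverse _), hinv.inverse_apply_self]
  exact graphChart_proj hJ h ⟨v, rfl⟩

lemma graphChart_graph (hJ : IsComplexStructure J) (L : Lagrangian J) (ψ : SymOp L.space) :
    graphChart L (L.graph hJ ψ) = ψ := by
  ext1 v
  have h := graphChart_proj hJ (L.graph_mem_graphDomain hJ ψ) (x := L.graphVec ψ v) ⟨v, rfl⟩
  rwa [proj_graphVec, proj_apply_graphVec hJ] at h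

lemma graph_graphChart (hJ : IsComplexStructure J) {L W : Lagrangian J} (hW : W ∈ graphDomain L) :
    L.graph hJ ⟨graphChart L W, isSelfAdjoint_graphChart hJ hW⟩ = W :=
  Lagrangian.ext (space_eq_range_graphVec hJ hW).symm

lemma mem_graphDomain_self (L : Lagrangian J) : L ∈ graphDomain L :=
  Submodule.isCompl_orthogonal L.space

/-- The set of `ψ` for which the graph lies in the domain of another chart is open. -/
lemma isOpen_isInvertible_proj_comp_graphVec (L L' : Lagrangian J) :
    IsOpen {ψ : L.space →L[ℝ] L.space | (L'.proj ∘L L.graphVec ψ).IsInvertible} := by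
  have h : Continuous fun ψ : L.space →L[ℝ] L.space => L'.proj ∘L L.graphVec ψ := by
    unfold graphVec
    fun_prop
  exact (ContinuousLinearEquiv.isOpen (𝕜 := ℝ) (E := L.space) (F := L'.space)).preimage h

end Lagrangian

end LagrangianGraphs

/-! ### Any two Lagrangian subspaces are isomorphic -/

section LagrangianIsomorphism

open Cardinal

namespace Lagrangian

variable {H : Type*} [NormedAddCommGroup H] [InnerProductSpace ℝ H] [CompleteSpace H]
  {J : H →L[ℝ] H}

lemma proj_eq_zero_of_forall_inner (L : Lagrangian J) {x : H}
    (h : ∀ j, inner ℝ (stdHilbertBasis L.space j : H) x = (0 : ℝ)) : L.proj x = 0 := by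
  set c := stdHilbertBasis L.space
  apply c.repr.injective
  ext j
  rw [c.repr_apply_apply, map_zero, real_inner_comm, inner_proj, real_inner_comm, h]
  rfl

/-- Because L' and J(L') span H, each basis vector of L fails to be orthogonal to some c_j or J c_j,
with (c_j) the basis of L'. Each of these vectors meets only countably many basis vectors of L in
this way. -/
lemma mk_stdIndex_le (hJ : IsComplexStructure J) (L L' : Lagrangian J) :
    #(stdIndex L.space) ≤ #(stdIndex L'.space) * ℵ₀ := by
  set b := stdHilbertBasis L.space
  set c := stdHilbertBasis L'.space
  have hcount : ∀ x : H, {i | inner ℝ (b i : H) x ≠ (0 : ℝ)}.Countable := fun x => by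
    have h1 := (b.orthonormal.inner_products_summable (L.proj x)).countable_support
    refine h1.mono fun i hi => ?_
    have h2 : inner ℝ (b i) (L.proj x) = (inner ℝ (b i : H) x : ℝ) := by
      rw [real_inner_comm, inner_proj, real_inner_comm]
    simpa [Function.mem_support, h2] using hi
  let S : stdIndex L'.space → Set (stdIndex L.space) := fun j =>
    {i | inner ℝ (b i : H) (c j : H) ≠ (0 : ℝ)} ∪ {i | inner ℝ (b i : H) (J (c j)) ≠ (0 : ℝ)}
  have hcover : ⋃ j, S j = Set.univ := by
    refine eq_univ_of_forall fun i => ?_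
    by_contra hi
    simp only [S, mem_iUnion, mem_union, mem_ofPred_eq, not_exists, not_or, not_not] at hi
    have h1 : (b i : H) ∈ L'.spaceᗮ := L'.space.orthogonalProjectionOnto_eq_zero_iff.1
      (L'.proj_eq_zero_of_forall_inner fun j => by rw [real_inner_comm]; exact (hi j).1)
    have h2 : J (b i) ∈ L'.spaceᗮ := L'.space.orthogonalProjectionOnto_eq_zero_iff.1
      (L'.proj_eq_zero_of_forall_inner fun j => by
        rw [real_inner_comm, hJ.inner_left, (hi j).2, neg_zero])
    have h3 : (b i : H) ∈ L'.space := by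
      have := L'.space.neg_mem (L'.apply_mem hJ h2)
      rwa [hJ.apply_apply, neg_neg] at this
    have h4 : (b i : H) = 0 :=
      Submodule.disjoint_def.1 L'.space.orthogonal_disjoint _ h3 h1
    exact b.orthonormal.ne_zero i (Subtype.ext h4)
  calc #(stdIndex L.space) = #(⋃ j, S j) := by rw [hcover, mk_univ]
    _ ≤ #(stdIndex L'.space) * ⨆ j, #(S j) := mk_iUnion_le S
    _ ≤ #(stdIndex L'.space) * ℵ₀ := by
      gcongr
      exact ciSup_le' fun j => ((hcount _).union (hcount _)).le_aleph0

/-- H = L' ⊕ J(L') is then finite-dimensional, and every Lagrangian has half its dimension. -/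
lemma nonempty_equiv_of_finite (hJ : IsComplexStructure J) (L L' : Lagrangian J)
    [Finite (stdIndex L'.space)] : Nonempty (L.space ≃L[ℝ] L'.space) := by
  have := Fintype.ofFinite (stdIndex L'.space)
  have hfin : FiniteDimensional ℝ L'.space :=
    (stdHilbertBasis L'.space).toOrthonormalBasis.toBasis.finiteDimensional_of_finite
  have hfin' : FiniteDimensional ℝ L'.spaceᗮ := by
    rw [← L'.map_eq]
    infer_instance
  have hH : FiniteDimensional ℝ H := by
    have : FiniteDimensional ℝ (⊤ : Submodule ℝ H) := by
      rw [← (L'.mem_graphDomain_self : IsCompl L'.space L'.spaceᗮ).sup_eq_top]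
      infer_instance
    exact Module.Finite.equiv (Submodule.topEquiv : (⊤ : Submodule ℝ H) ≃ₗ[ℝ] H)
  have hker : LinearMap.ker (J : H →ₗ[ℝ] H) = ⊥ := LinearMap.ker_eq_bot'.2 fun x hx => by
    rw [← neg_eq_zero, ← hJ.apply_apply]
    exact (congrArg J hx).trans (map_zero J)
  have hdim : ∀ K : Lagrangian J, Module.finrank ℝ K.space + Module.finrank ℝ K.space =
      Module.finrank ℝ H := fun K => by
    rw [← K.space.finrank_add_finrank_orthogonal, ← K.map_eq,
      (Submodule.equivMapOfInjective (J : H →ₗ[ℝ] H) (LinearMap.ker_eq_bot.1 hker)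
        K.space).finrank_eq]
  exact ⟨ContinuousLinearEquiv.ofFinrankEq (by have := hdim L; have := hdim L'; omega)⟩

/-- Any two Lagrangian subspaces are isomorphic. -/
lemma nonempty_equiv (hJ : IsComplexStructure J) (L L' : Lagrangian J) :
    Nonempty (L.space ≃L[ℝ] L'.space) := by
  rcases finite_or_infinite (stdIndex L'.space) with h' | h'
  · exact nonempty_equiv_of_finite hJ L L'
  rcases finite_or_infinite (stdIndex L.space) with h | h
  · exact (nonempty_equiv_of_finite hJ L' L).map ContinuousLinearEquiv.symm
  -- For an infinite cardinal the factor ℵ₀ is absorbed.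
  have hle : ∀ L L' : Lagrangian J, Infinite (stdIndex L'.space) →
      #(stdIndex L.space) ≤ #(stdIndex L'.space) := fun L L' h => by
    simpa [mul_aleph0_eq (aleph0_le_mk _)] using mk_stdIndex_le hJ L L'
  obtain ⟨e⟩ := Cardinal.eq.1 ((hle L L' h').antisymm (hle L' L h))
  set c := stdHilbertBasis L'.space
  let c' : HilbertBasis (stdIndex L.space) ℝ L'.space :=
    HilbertBasis.mk (c.orthonormal.comp e e.injective) (by
      rw [e.surjective.range_comp, c.dense_span])
  exact ⟨((stdHilbertBasis L.space).repr.trans c'.repr.symm).toContinuousLinearEquiv⟩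

end Lagrangian

end LagrangianIsomorphism

/-! ### Hilbert-Schmidt properties of the restricted orbit -/

section RestrictedOrbit

variable {H : Type*} [NormedAddCommGroup H] [InnerProductSpace ℝ H] [CompleteSpace H]
  {J : H →L[ℝ] H}

omit [CompleteSpace H] in
lemma symm_mem_symplecticGroup {g : H ≃L[ℝ] H} (hg : g ∈ symplecticGroup J) :
    g.symm ∈ symplecticGroup J := fun ξ η => by
  rw [← hg, g.apply_symm_apply, g.apply_symm_apply]

omit [CompleteSpace H] in
lemma trans_mem_symplecticGroup {g h : H ≃L[ℝ] H} (hg : g ∈ symplecticGroup J)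
    (hh : h ∈ symplecticGroup J) : g.trans h ∈ symplecticGroup J := fun _ _ =>
  (hh _ _).trans (hg _ _)

/-- hg - 1 = (h - 1)g + (g - 1). -/
lemma trans_mem_restrictedSymplecticGroup {g h : H ≃L[ℝ] H}
    (hg : g ∈ restrictedSymplecticGroup J) (hh : h ∈ restrictedSymplecticGroup J) :
    g.trans h ∈ restrictedSymplecticGroup J := by
  refine ⟨trans_mem_symplecticGroup hg.1 hh.1, ?_⟩
  convert (hh.2.comp_right (g : H →L[ℝ] H)).add hg.2 using 1
  ext x
  simp

/-- g⁻¹ - 1 = -(g - 1)g⁻¹. -/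
lemma symm_mem_restrictedSymplecticGroup {g : H ≃L[ℝ] H}
    (hg : g ∈ restrictedSymplecticGroup J) : g.symm ∈ restrictedSymplecticGroup J := by
  refine ⟨symm_mem_symplecticGroup hg.1, ?_⟩
  convert (hg.2.comp_right (g.symm : H →L[ℝ] H)).neg using 1
  ext x
  simp

lemma mem_restrictedOrbit_trans {L₀ L W : Lagrangian J} (hL : L ∈ restrictedOrbit L₀)
    (hW : W ∈ restrictedOrbit L) : W ∈ restrictedOrbit L₀ := by
  obtain ⟨g, hg, hL⟩ := hL
  obtain ⟨h, hh, hW⟩ := hW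
  refine ⟨g.trans h, trans_mem_restrictedSymplecticGroup hg hh, ?_⟩
  rw [hW, hL, ← Submodule.map_comp]
  rfl

lemma mem_restrictedOrbit_symm {L₀ L : Lagrangian J} (hL : L ∈ restrictedOrbit L₀) :
    L₀ ∈ restrictedOrbit L := by
  obtain ⟨g, hg, hL⟩ := hL
  refine ⟨g.symm, symm_mem_restrictedSymplecticGroup hg, ?_⟩
  ext x
  rw [hL]
  constructor
  · intro hx
    exact ⟨g x, ⟨x, hx, rfl⟩, g.symm_apply_apply x⟩
  · rintro ⟨_, ⟨y, hy, rfl⟩, rfl⟩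
    exact (g.symm_apply_apply y).symm ▸ hy

namespace Lagrangian

/-- The shear `1 - J ψ P`, a symplectic transformation that maps `L` to the graph of `-J ψ`. -/
noncomputable def shear (L : Lagrangian J) (ψ : L.space →L[ℝ] L.space) : H ≃L[ℝ] H :=
  ContinuousLinearEquiv.equivOfInverse
    (ContinuousLinearMap.id ℝ H - J ∘L L.space.subtypeL ∘L ψ ∘L L.proj)
    (ContinuousLinearMap.id ℝ H + J ∘L L.space.subtypeL ∘L ψ ∘L L.proj)
    -- JψP has square zero because PJ vanishes on L.
    (fun x => by simp [map_sub, L.proj_apply_coe])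
    (fun x => by simp [map_add, L.proj_apply_coe])

lemma shear_apply (L : Lagrangian J) (ψ : L.space →L[ℝ] L.space) (x : H) :
    L.shear ψ x = x - J (ψ (L.proj x)) := rfl

lemma shear_mem_symplecticGroup (hJ : IsComplexStructure J) (L : Lagrangian J)
    (ψ : SymOp L.space) : L.shear ψ ∈ symplecticGroup J := fun ξ η => by
  have h1 : inner ℝ (((ψ : L.space →L[ℝ] L.space) (L.proj ξ) : L.space) : H) η =
      (inner ℝ ξ (((ψ : L.space →L[ℝ] L.space) (L.proj η) : L.space) : H) : ℝ) := by
    rw [real_inner_comm, ← inner_proj, ← inner_proj, real_inner_comm]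
    exact ContinuousLinearMap.isSelfAdjoint_iff_isSymmetric.1 ψ.2 _ _
  rw [symplecticForm, symplecticForm, shear_apply, shear_apply, map_sub, hJ.apply_apply,
    sub_neg_eq_add, inner_sub_right, inner_add_left, inner_add_left, hJ.inner_apply_apply,
    L.inner_apply_right (Subtype.mem _) (Subtype.mem _), h1]
  ring

lemma graph_mem_restrictedOrbit (hJ : IsComplexStructure J) (L : Lagrangian J)
    (ψ : HSSym L.space) : L.graph hJ (HSSym.toSymOp L.space ψ) ∈ restrictedOrbit L := by
  refine ⟨L.shear ψ.toCLM, ⟨L.shear_mem_symplecticGroup hJ (HSSym.toSymOp L.space ψ), ?_⟩, ?_⟩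
  · have hψ : IsHilbertSchmidt ψ.toCLM := ψ.2.2
    convert ((hψ.comp_right L.proj).comp_left (J ∘L L.space.subtypeL)).neg using 1
    ext x
    simp [shear_apply]
  · ext x
    constructor
    · rintro ⟨v, rfl⟩
      refine ⟨v, v.2, ?_⟩
      change (v : H) - J (ψ.toCLM (L.proj v)) = v - J (ψ.toCLM v)
      rw [proj_coe]
    · rintro ⟨v, hv, rfl⟩
      refine ⟨⟨v, hv⟩, ?_⟩
      change (v : H) - J (ψ.toCLM ⟨v, hv⟩) = v - J (ψ.toCLM (L.proj v))
      rw [← L.proj_coe ⟨v, hv⟩]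

/-- PJ kills L, so h may be replaced by the Hilbert-Schmidt operator h - 1. -/
lemma proj_comp_map_sub_id (L : Lagrangian J) (h : H →L[ℝ] H) :
    L.proj ∘L J ∘L h ∘L L.space.subtypeL =
      (L.proj ∘L J) ∘L (h - ContinuousLinearMap.id ℝ H) ∘L L.space.subtypeL := by
  ext1 v
  simp [L.proj_apply_coe]

/-- If W = h(L), then h|_L parametrizes W and φ_L(W) = (PJh|_L)(Ph|_L)⁻¹, whose first factor is
Hilbert-Schmidt. -/
lemma isHilbertSchmidt_graphChart (hJ : IsComplexStructure J) {L W : Lagrangian J}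
    (hW : W ∈ graphDomain L) (hWL : W ∈ restrictedOrbit L) :
    IsHilbertSchmidt (graphChart L W) := by
  obtain ⟨h, hh, hmap⟩ := hWL
  have hrange : W.space = LinearMap.range (((h : H →L[ℝ] H) ∘L L.space.subtypeL : L.space →L[ℝ] H) :
      L.space →ₗ[ℝ] H) := by
    ext x
    rw [hmap]
    constructor
    · rintro ⟨v, hv, rfl⟩
      exact ⟨⟨v, hv⟩, rfl⟩
    · rintro ⟨v, rfl⟩
      exact ⟨v, v.2, rfl⟩
  have hinv := (mem_graphDomain_iff_isInvertible
    (fun u v huv => Subtype.ext (h.injective huv)) hrange).1 hW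
  have heq : graphChart L W = (L.proj ∘L J ∘L (h : H →L[ℝ] H) ∘L L.space.subtypeL) ∘L
      (L.proj ∘L (h : H →L[ℝ] H) ∘L L.space.subtypeL).inverse := by
    ext1 x
    obtain ⟨v, rfl⟩ := hinv.surjective x
    rw [ContinuousLinearMap.comp_apply _ (ContinuousLinearMap.inverse _), hinv.inverse_apply_self]
    exact graphChart_proj hJ hW (hrange ▸ ⟨v, rfl⟩)
  rw [heq, proj_comp_map_sub_id]
  exact ((hh.2.comp_right _).comp_left _).comp_right _

/-- With L = h(L'), it equals P'J(h - 1)h⁻¹ on L. This is the constant term of the transition maps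
of the orbit. -/
lemma isHilbertSchmidt_proj_comp {L L' : Lagrangian J} (hL : L ∈ restrictedOrbit L') :
    IsHilbertSchmidt (L'.proj ∘L J ∘L L.space.subtypeL) := by
  obtain ⟨h, hh, hmap⟩ := hL
  convert (hh.2.comp_right ((h.symm : H →L[ℝ] H) ∘L L.space.subtypeL)).comp_left
    (L'.proj ∘L J) using 1
  ext1 v
  have hv : h.symm (v : H) ∈ L'.space := by
    obtain ⟨u, hu, huv⟩ : (v : H) ∈ L'.space.map (h : H →ₗ[ℝ] H) := hmap.le v.2
    rw [← huv]
    exact (h.symm_apply_apply u).symm ▸ hu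
  simp [L'.proj_apply_coe ⟨_, hv⟩]

end Lagrangian

end RestrictedOrbit

/-! ### The charts -/

namespace SymOp

variable {E F : Type*} [NormedAddCommGroup E] [InnerProductSpace ℝ E] [CompleteSpace E]
  [NormedAddCommGroup F] [InnerProductSpace ℝ F] [CompleteSpace F]

/-- Smoothness between spaces of symmetric operators follows from a formula on all bounded
operators, since the symmetric part is a continuous linear retraction. -/
lemma contDiffOn_symPart_comp_coe {f : (E →L[ℝ] E) → (F →L[ℝ] F)} {s : Set (E →L[ℝ] E)}
    (hf : ContDiffOn ℝ ∞ f s) {g : SymOp E → SymOp F} {t : Set (SymOp E)}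
    (ht : ∀ ψ ∈ t, (ψ : E →L[ℝ] E) ∈ s) (hg : ∀ ψ ∈ t, g ψ = symPart F (f ψ)) :
    ContDiffOn ℝ ∞ g t := by
  have hval : ContDiff ℝ ∞ (selfAdjoint.submodule ℝ (E →L[ℝ] E)).subtypeL :=
    ContinuousLinearMap.contDiff _
  have hsym : ContDiff ℝ ∞ (symPart F) := ContinuousLinearMap.contDiff _
  exact (hsym.comp_contDiffOn (hf.comp hval.contDiffOn ht)).congr hg

end SymOp

namespace HSSym

variable {E : Type*} [NormedAddCommGroup E] [InnerProductSpace ℝ E] [CompleteSpace E]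

open Classical in
/-- A symmetric Hilbert-Schmidt operator as an element of `HSSym E`; other operators go to `0`. -/
noncomputable def ofCLM (a : E →L[ℝ] E) : HSSym E :=
  if h : a ∈ hsSymSubmodule E then (⟨a, h⟩ : hsSymSubmodule E) else (0 : hsSymSubmodule E)

lemma toCLM_ofCLM {a : E →L[ℝ] E} (h : a ∈ hsSymSubmodule E) : (ofCLM a).toCLM = a :=
  congrArg toCLM (dif_pos h)

lemma toSymOp_injective : Function.Injective (toSymOp E) := fun _ _ h =>
  HSSym.ext (congrArg (fun ψ : SymOp E => (ψ : E →L[ℝ] E)) h)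

end HSSym

section Charts

variable {H : Type*} [NormedAddCommGroup H] [InnerProductSpace ℝ H] [CompleteSpace H]
  {J : H →L[ℝ] H}

namespace Lagrangian

/-- The chart `φ_L : Ω(Lᗮ) → B(L)_s`. -/
noncomputable def chart (hJ : IsComplexStructure J) (L : Lagrangian J) :
    PartialEquiv (Lagrangian J) (SymOp L.space) where
  -- Off the domain `graphChart L W` need not be symmetric; on it, `symPart` changes nothing.
  toFun W := SymOp.symPart L.space (graphChart L W)
  invFun := L.graph hJ
  source := graphDomain L
  target := univ
  map_source' _ _ := mem_univ _
  map_target' ψ _ := L.graph_mem_graphDomain hJ ψ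
  left_inv' W hW := by
    rw [← graph_graphChart hJ hW]
    congr 1
    exact Subtype.ext ((congrArg _ (congrArg _ (congrArg _ (graph_graphChart hJ hW)))).trans
      (SymOp.coe_symPart _ (isSelfAdjoint_graphChart hJ hW)))
  right_inv' ψ _ := Subtype.ext (by
    rw [graphChart_graph hJ]
    exact SymOp.coe_symPart _ ψ.2)

lemma coe_chart (hJ : IsComplexStructure J) {L W : Lagrangian J} (hW : W ∈ graphDomain L) :
    (L.chart hJ W : L.space →L[ℝ] L.space) = graphChart L W :=
  SymOp.coe_symPart _ (isSelfAdjoint_graphChart hJ hW)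

omit [CompleteSpace H] in
lemma contDiff_proj_comp_graphVec (L : Lagrangian J) {E : Type*} [NormedAddCommGroup E]
    [NormedSpace ℝ E] (A : H →L[ℝ] E) :
    ContDiff ℝ ∞ fun ψ : L.space →L[ℝ] L.space => A ∘L L.graphVec ψ := by
  unfold graphVec
  fun_prop

lemma contDiffOn_inverse_proj_comp_graphVec (L L' : Lagrangian J) :
    ContDiffOn ℝ ∞ (fun ψ : L.space →L[ℝ] L.space => (L'.proj ∘L L.graphVec ψ).inverse)
      {ψ | (L'.proj ∘L L.graphVec ψ).IsInvertible} := fun ψ hψ => by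
  have hinv : (L'.proj ∘L L.graphVec ψ).IsInvertible := hψ
  have h : ContDiffAt ℝ ∞ (ContinuousLinearMap.inverse : (L.space →L[ℝ] L'.space) → _)
      (L'.proj ∘L L.graphVec ψ) := hinv.contDiffAt_map_inverse
  exact (h.comp ψ (L.contDiff_proj_comp_graphVec L'.proj).contDiffAt).contDiffWithinAt

lemma preimage_chart_source (hJ : IsComplexStructure J) (L L' : Lagrangian J) :
    (L.chart hJ).symm ⁻¹' (L'.chart hJ).source =
      {ψ : SymOp L.space | (L'.proj ∘L L.graphVec ψ).IsInvertible} :=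
  Set.ext fun ψ => graph_mem_graphDomain_iff hJ L L' ψ

lemma isOpen_preimage_chart_source (hJ : IsComplexStructure J) (L L' : Lagrangian J) :
    IsOpen ((L.chart hJ).symm ⁻¹' (L'.chart hJ).source) := by
  rw [preimage_chart_source]
  exact (isOpen_isInvertible_proj_comp_graphVec L L').preimage continuous_subtype_val

set_option synthInstance.maxHeartbeats 200000 in
lemma contDiffOn_chart_comp_symm (hJ : IsComplexStructure J) (L L' : Lagrangian J) :
    ContDiffOn ℝ ∞ (L'.chart hJ ∘ (L.chart hJ).symm)
      ((L.chart hJ).symm ⁻¹' (L'.chart hJ).source) := by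
  have h : ContDiffOn ℝ ∞ (fun ψ : L.space →L[ℝ] L.space =>
      (L'.proj ∘L J ∘L L.graphVec ψ) ∘L (L'.proj ∘L L.graphVec ψ).inverse)
      {ψ | (L'.proj ∘L L.graphVec ψ).IsInvertible} :=
    (L.contDiff_proj_comp_graphVec (L'.proj ∘L J)).contDiffOn.clm_comp
      (contDiffOn_inverse_proj_comp_graphVec L L')
  rw [preimage_chart_source]
  refine SymOp.contDiffOn_symPart_comp_coe h (fun ψ hψ => hψ) fun ψ hψ => ?_
  change SymOp.symPart L'.space (graphChart L' (L.graph hJ ψ)) = _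
  rw [graphChart_graph_comp hJ ((graph_mem_graphDomain_iff hJ L L' ψ).2 hψ)]

end Lagrangian

namespace RestrictedOrbit

open Lagrangian

variable {L₀ : Lagrangian J}

lemma isHilbertSchmidt_graphChart (hJ : IsComplexStructure J) (L W : RestrictedOrbit L₀)
    (hW : incl L₀ W ∈ graphDomain (incl L₀ L)) :
    IsHilbertSchmidt (graphChart (incl L₀ L) (incl L₀ W)) :=
  Lagrangian.isHilbertSchmidt_graphChart hJ hW
    (mem_restrictedOrbit_trans (mem_restrictedOrbit_symm L.2) W.2)

/-- The chart `Ω(Lᗮ) ∩ O → B₂(L)_s` of the restricted orbit. -/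
noncomputable def chart (hJ : IsComplexStructure J) (L : RestrictedOrbit L₀) :
    PartialEquiv (RestrictedOrbit L₀) (HSSym (incl L₀ L).space) where
  toFun W := HSSym.ofCLM (graphChart (incl L₀ L) (incl L₀ W))
  invFun ψ := ⟨(incl L₀ L).graph hJ (HSSym.toSymOp _ ψ),
    mem_restrictedOrbit_trans L.2 (graph_mem_restrictedOrbit hJ _ ψ)⟩
  source := incl L₀ ⁻¹' graphDomain (incl L₀ L)
  target := univ
  map_source' _ _ := mem_univ _
  map_target' ψ _ := graph_mem_graphDomain hJ _ _
  left_inv' W hW := by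
    have h : HSSym.toSymOp _ (HSSym.ofCLM (graphChart (incl L₀ L) (incl L₀ W))) =
        ⟨graphChart (incl L₀ L) (incl L₀ W), isSelfAdjoint_graphChart hJ hW⟩ :=
      Subtype.ext (HSSym.toCLM_ofCLM
        ⟨isSelfAdjoint_graphChart hJ hW, isHilbertSchmidt_graphChart hJ L W hW⟩)
    exact Subtype.ext ((congrArg ((incl L₀ L).graph hJ) h).trans (graph_graphChart hJ hW))
  right_inv' ψ _ := by
    change HSSym.ofCLM (graphChart (incl L₀ L) ((incl L₀ L).graph hJ (HSSym.toSymOp _ ψ))) = ψ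
    rw [graphChart_graph]
    exact HSSym.ext (HSSym.toCLM_ofCLM ψ.2)

lemma toCLM_chart (hJ : IsComplexStructure J) (L W : RestrictedOrbit L₀)
    (hW : incl L₀ W ∈ graphDomain (incl L₀ L)) :
    (L.chart hJ W).toCLM = graphChart (incl L₀ L) (incl L₀ W) :=
  HSSym.toCLM_ofCLM ⟨isSelfAdjoint_graphChart hJ hW, isHilbertSchmidt_graphChart hJ L W hW⟩

lemma preimage_chart_source (hJ : IsComplexStructure J) (L L' : RestrictedOrbit L₀) :
    (L.chart hJ).symm ⁻¹' (L'.chart hJ).source = HSSym.toSymOp (incl L₀ L).space ⁻¹'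
      (((incl L₀ L).chart hJ).symm ⁻¹' ((incl L₀ L').chart hJ).source) := rfl

/-- The numerator b + aψ is affine into the Hilbert-Schmidt operators. The inverse factor need only
be smooth in operator norm, because right composition is jointly bounded from operator norm and
2-norm to 2-norm. -/
lemma contDiffOn_chart_comp_symm (hJ : IsComplexStructure J) (L L' : RestrictedOrbit L₀) :
    ContDiffOn ℝ ∞ (L'.chart hJ ∘ (L.chart hJ).symm)
      ((L.chart hJ).symm ⁻¹' (L'.chart hJ).source) := by
  set K := incl L₀ L
  set K' := incl L₀ L'
  let a : K.space →L[ℝ] K'.space := K'.proj ∘L K.space.subtypeL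
  let b : HSOp K.space K'.space := ⟨K'.proj ∘L J ∘L K.space.subtypeL, isHilbertSchmidt_proj_comp
    (mem_restrictedOrbit_trans (mem_restrictedOrbit_symm L'.2) L.2)⟩
  have hval : ContDiff ℝ ∞ fun ψ : HSSym K.space => ψ.toCLM :=
    (HSOp.toCLMₗ K.space K.space ∘L HSSym.toHSOp K.space).contDiff
  have hnum : ContDiff ℝ ∞ fun ψ : HSSym K.space =>
      b + HSOp.compLeft a (HSSym.toHSOp K.space ψ) :=
    contDiff_const.add (HSOp.compLeft a ∘L HSSym.toHSOp K.space).contDiff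
  have hinv : ContDiffOn ℝ ∞
      (fun ψ : HSSym K.space => (K'.proj ∘L K.graphVec ψ.toCLM).inverse)
      {ψ : HSSym K.space | (K'.proj ∘L K.graphVec ψ.toCLM).IsInvertible} :=
    (contDiffOn_inverse_proj_comp_graphVec K K').comp hval.contDiffOn fun ψ hψ => hψ
  have hright : ContDiffOn ℝ ∞ (fun ψ : HSSym K.space =>
      HSOp.compRight (F := K'.space) (K'.proj ∘L K.graphVec ψ.toCLM).inverse)
      {ψ : HSSym K.space | (K'.proj ∘L K.graphVec ψ.toCLM).IsInvertible} :=
    (HSOp.compRight (D := K'.space) (E := K.space) (F := K'.space)).contDiff.comp_contDiffOn hinv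
  have h : ContDiffOn ℝ ∞ (fun ψ : HSSym K.space => HSOp.symPart
      (HSOp.compRight (K'.proj ∘L K.graphVec ψ.toCLM).inverse
        (b + HSOp.compLeft a (HSSym.toHSOp K.space ψ))))
      {ψ : HSSym K.space | (K'.proj ∘L K.graphVec ψ.toCLM).IsInvertible} :=
    HSOp.symPart.contDiff.comp_contDiffOn (hright.clm_apply hnum.contDiffOn)
  rw [preimage_chart_source, Lagrangian.preimage_chart_source]
  refine h.congr fun ψ hψ => HSSym.ext ?_
  have hmem : K.graph hJ (HSSym.toSymOp K.space ψ) ∈ graphDomain K' :=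
    (graph_mem_graphDomain_iff hJ K K' _).2 hψ
  have heq : graphChart K' (K.graph hJ (HSSym.toSymOp K.space ψ)) =
      (HSOp.compRight (K'.proj ∘L K.graphVec ψ.toCLM).inverse
        (b + HSOp.compLeft a (HSSym.toHSOp K.space ψ))).toCLM := by
    rw [graphChart_graph_comp hJ hmem]
    change _ = (K'.proj ∘L J ∘L K.space.subtypeL + (K'.proj ∘L K.space.subtypeL) ∘L ψ.toCLM) ∘L
      (K'.proj ∘L K.graphVec ψ.toCLM).inverse
    refine congrArg (· ∘L _) (ContinuousLinearMap.ext fun v => ?_)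
    change K'.proj (J (K.graphVec ψ.toCLM v)) = K'.proj (J v) + K'.proj (ψ.toCLM v)
    rw [apply_graphVec hJ, map_add]
  rw [HSOp.toCLM_symPart _ (heq ▸ isSelfAdjoint_graphChart hJ hmem), ← heq]
  exact toCLM_chart hJ L' _ hmem

end RestrictedOrbit

end Charts

/-! ### The two manifold structures and the immersion -/

set_option maxHeartbeats 1000000 in
set_option synthInstance.maxHeartbeats 200000 in
theorem mainTheorem2 {H : Type*} [NormedAddCommGroup H] [InnerProductSpace ℝ H] [CompleteSpace H]
    (J : H →L[ℝ] H) (hJ : J ∘L J = -ContinuousLinearMap.id ℝ H)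
    (hJ' : ContinuousLinearMap.adjoint J = -J) (L₀ : Lagrangian J) :
    ∃ (_ : TopologicalSpace (Lagrangian J))
      (_ : ChartedSpace (SymOp L₀.space) (Lagrangian J))
      (_ : TopologicalSpace (RestrictedOrbit L₀))
      (_ : ChartedSpace (HSSym L₀.space) (RestrictedOrbit L₀)),
      -- `Λ(H)` is a smooth Banach manifold with charts `φ_L : Ω(Lᗮ) → B(L)_s`
      IsManifold 𝓘(ℝ, SymOp L₀.space) ∞ (Lagrangian J) ∧
      (∀ L : Lagrangian J, ∃ e : OpenPartialHomeomorph (Lagrangian J) (SymOp L.space),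
        e.source = graphDomain L ∧ e.target = univ ∧
        (∀ W ∈ graphDomain L, (e W : L.space →L[ℝ] L.space) = graphChart L W) ∧
        ContMDiffOn 𝓘(ℝ, SymOp L₀.space) 𝓘(ℝ, SymOp L.space) ∞ e e.source ∧
        ContMDiffOn 𝓘(ℝ, SymOp L.space) 𝓘(ℝ, SymOp L₀.space) ∞ e.symm e.target) ∧
      -- `O_{L₀}` is a smooth Hilbert manifold with charts `φ_L| : Ω(Lᗮ) ∩ O_{L₀} → B₂(L)_s`
      IsManifold 𝓘(ℝ, HSSym L₀.space) ∞ (RestrictedOrbit L₀) ∧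
      (∀ L ∈ restrictedOrbit L₀,
        graphChart L '' (graphDomain L ∩ restrictedOrbit L₀) =
          {ψ | IsSelfAdjoint ψ ∧ IsHilbertSchmidt ψ} ∧
        ∃ e : OpenPartialHomeomorph (RestrictedOrbit L₀) (HSSym L.space),
          e.source = RestrictedOrbit.incl L₀ ⁻¹' graphDomain L ∧ e.target = univ ∧
          (∀ W ∈ e.source, (e W).toCLM = graphChart L (RestrictedOrbit.incl L₀ W)) ∧
          ContMDiffOn 𝓘(ℝ, HSSym L₀.space) 𝓘(ℝ, HSSym L.space) ∞ e e.source ∧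
          ContMDiffOn 𝓘(ℝ, HSSym L.space) 𝓘(ℝ, HSSym L₀.space) ∞ e.symm e.target) ∧
      -- the inclusion is an immersion: smooth, with injective differential at every point
      ContMDiff 𝓘(ℝ, HSSym L₀.space) 𝓘(ℝ, SymOp L₀.space) ∞ (RestrictedOrbit.incl L₀) ∧
      ∀ W : RestrictedOrbit L₀, Function.Injective
        (mfderiv 𝓘(ℝ, HSSym L₀.space) 𝓘(ℝ, SymOp L₀.space) (RestrictedOrbit.incl L₀) W) := by
  have hc : IsComplexStructure J := ⟨hJ, hJ'⟩
  let S := fun L : Lagrangian J => (Lagrangian.nonempty_equiv hc L L₀).some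
  obtain ⟨tΛ, cΛ, mΛ, hΛ⟩ := exists_manifold_of_charts (E := SymOp L₀.space)
    (F := fun L : Lagrangian J => SymOp L.space) (fun L : Lagrangian J => L.chart hc)
    (fun L => SymOp.congr (S L)) (fun _ => rfl) (fun W => ⟨W, W.mem_graphDomain_self⟩)
    (Lagrangian.isOpen_preimage_chart_source hc) (Lagrangian.contDiffOn_chart_comp_symm hc)
  obtain ⟨tO, cO, mO, hO⟩ := exists_manifold_of_charts (E := HSSym L₀.space)
    (F := fun L : RestrictedOrbit L₀ => HSSym (RestrictedOrbit.incl L₀ L).space)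
    (fun L : RestrictedOrbit L₀ => L.chart hc)
    (fun L => HSSym.congr (S (RestrictedOrbit.incl L₀ L))) (fun _ => rfl)
    (fun W => ⟨W, (RestrictedOrbit.incl L₀ W).mem_graphDomain_self⟩)
    (fun L L' => (Lagrangian.isOpen_preimage_chart_source hc _ _).preimage
      (HSSym.toSymOp (RestrictedOrbit.incl L₀ L).space).continuous)
    (RestrictedOrbit.contDiffOn_chart_comp_symm hc)
  have himm : ∀ W : RestrictedOrbit L₀,
      ContMDiffAt 𝓘(ℝ, HSSym L₀.space) 𝓘(ℝ, SymOp L₀.space) ∞ (RestrictedOrbit.incl L₀) W ∧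
      Function.Injective
        (mfderiv 𝓘(ℝ, HSSym L₀.space) 𝓘(ℝ, SymOp L₀.space) (RestrictedOrbit.incl L₀) W) := by
    intro W
    -- Both charts are centred at W; between them the inclusion becomes `HSSym.toSymOp`.
    obtain ⟨e, he, hes, het⟩ := hO W
    obtain ⟨e', he', hes', het'⟩ := hΛ (RestrictedOrbit.incl L₀ W)
    have hsource : e.source = RestrictedOrbit.incl L₀ ⁻¹' graphDomain (RestrictedOrbit.incl L₀ W) :=
      congrArg PartialEquiv.source he
    have hsource' : e'.source = graphDomain (RestrictedOrbit.incl L₀ W) :=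
      congrArg PartialEquiv.source he'
    have hcoe : ∀ V, e V = W.chart hc V := fun V => congrArg (fun p => p.toFun V) he
    have hcoe' : ∀ V, e' V = (RestrictedOrbit.incl L₀ W).chart hc V :=
      fun V => congrArg (fun p => p.toFun V) he'
    refine contMDiffAt_and_injective_mfderiv_of_charts e ?_ hes het e' ?_ hes' het'
      (HSSym.toSymOp _) HSSym.toSymOp_injective ?_
    · rw [hsource]
      exact (RestrictedOrbit.incl L₀ W).mem_graphDomain_self
    · intro V hV
      rw [hsource] at hV
      rw [hsource']
      exact hV
    · intro V hV
      rw [hsource] at hV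
      rw [hcoe, hcoe']
      exact Subtype.ext ((Lagrangian.coe_chart hc hV).trans
        (RestrictedOrbit.toCLM_chart hc W V hV).symm)
  refine ⟨tΛ, cΛ, tO, cO, mΛ, fun L => ?_, mO, fun L hL => ⟨?_, ?_⟩, fun W => (himm W).1,
    fun W => (himm W).2⟩
  · obtain ⟨e, he, hes, het⟩ := hΛ L
    refine ⟨e, congrArg PartialEquiv.source he, congrArg PartialEquiv.target he, fun W hW => ?_,
      hes, het⟩
    exact (congrArg (fun p => (p.toFun W : L.space →L[ℝ] L.space)) he).trans
      (Lagrangian.coe_chart hc hW)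
  · ext ψ
    constructor
    · rintro ⟨W, ⟨hW, hWO⟩, rfl⟩
      exact ⟨Lagrangian.isSelfAdjoint_graphChart hc hW,
        RestrictedOrbit.isHilbertSchmidt_graphChart hc (⟨L, hL⟩ : RestrictedOrbit L₀) ⟨W, hWO⟩ hW⟩
    · intro hψ
      let χ : HSSym L.space := ⟨ψ, hψ⟩
      exact ⟨L.graph hc (HSSym.toSymOp _ χ), ⟨L.graph_mem_graphDomain hc _,
        mem_restrictedOrbit_trans hL (L.graph_mem_restrictedOrbit hc χ)⟩,
        Lagrangian.graphChart_graph hc L _⟩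
  · obtain ⟨e, he, hes, het⟩ := hO ⟨L, hL⟩
    have hsource : e.source = RestrictedOrbit.incl L₀ ⁻¹' graphDomain L :=
      congrArg PartialEquiv.source he
    refine ⟨e, hsource, congrArg PartialEquiv.target he, fun W hW => ?_, hes, het⟩
    rw [hsource] at hW
    exact (congrArg (fun p => (p.toFun W).toCLM) he).trans
      (RestrictedOrbit.toCLM_chart hc ⟨L, hL⟩ W hW)
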